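/- **Theorem 3.1.** Let $n$ be a positive integer and let $\beta$ be a real number with $\beta \ge n$ and $\beta > 1$. Let $\nu_\beta$ be the generalized Cauchy distribution on $\mathbb{R}^n$, that is, the probability measure with density $$\frac{d\nu_\beta(x)}{dx} = \frac1Z\,(1+|x|^2)^{-\beta}, \qquad Z = \int_{\mathbb{R}^n} (1+|x|^2)^{-\beta}\,dx,$$ where $|\cdot|$ is the Euclidean norm. Then for every bounded smooth ($C^\infty$) function $g : \mathbb{R}^n \to \mathbb{R}$, $$\mathrm{Var}_{\nu_\beta}(g) \le \frac{C_\beta}{2(\beta-1)} \int_{\mathbb{R}^n} |\nabla g(x)|^2\,(1+|x|^2)\, d\nu_\beta(x), \qquad C_\beta = \left(\sqrt{1+\tfrac{2}{\beta-1}} + \sqrt{\tfrac{2}{\beta-1}}\right)^2,$$ where $\mathrm{Var}_{\nu_\beta}(g) = \int g^2\,d\nu_\beta - \left(\int g\,d\nu_\beta\right)^2$ and the integral on the right-hand side may be $+\infty$. Moreover, $C_\beta \to 1$ as $\beta \to +\infty$. -/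

import Mathlib

open Filter MeasureTheory ProbabilityTheory
open scoped Topology ContDiff

noncomputable section

/-- The normalizing constant `Z = ∫ (1 + |x|²)^{-β} dx` over Euclidean space `ℝⁿ`. -/
def cauchyZ (n : ℕ) (β : ℝ) : ℝ :=
  ∫ x : EuclideanSpace ℝ (Fin n), (1 + ‖x‖ ^ 2) ^ (-β)

/-- The generalized Cauchy distribution `ν_β` on `ℝⁿ`: the measure with density
`(1 / Z) (1 + |x|²)^{-β}` with respect to Lebesgue measure (used for `β > n / 2`). -/
def genCauchy (n : ℕ) (β : ℝ) : Measure (EuclideanSpace ℝ (Fin n)) :=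
  volume.withDensity fun x => ENNReal.ofReal (1 / cauchyZ n β * (1 + ‖x‖ ^ 2) ^ (-β))

/-- The constant `C_β = (√(1 + 2/(β-1)) + √(2/(β-1)))²` (used for `β > 1`). -/
def cauchyC (β : ℝ) : ℝ :=
  (√(1 + 2 / (β - 1)) + √(2 / (β - 1))) ^ 2

/-- For `β > n / 2` the generalized Cauchy distribution is a probability measure. -/
theorem isProbabilityMeasure_genCauchy (n : ℕ) (β : ℝ) (hβ : (n : ℝ) / 2 < β) :
    IsProbabilityMeasure (genCauchy n β) := by
  have hi : Integrable (fun x : EuclideanSpace ℝ (Fin n) => (1 + ‖x‖ ^ 2) ^ (-β)) := by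
    have h := integrable_rpow_neg_one_add_norm_sq (E := EuclideanSpace ℝ (Fin n))
      (μ := volume) (r := 2 * β) (by rw [finrank_euclideanSpace_fin]; linarith)
    have e : -(2 * β) / 2 = -β := by ring
    simpa only [e] using h
  have hp : ∀ x : EuclideanSpace ℝ (Fin n), 0 < (1 + ‖x‖ ^ 2) ^ (-β) := fun x => by positivity
  have hZ : 0 < cauchyZ n β := by
    unfold cauchyZ
    rw [integral_pos_iff_support_of_nonneg (fun x => (hp x).le) hi]
    have hs : (Function.support fun x : EuclideanSpace ℝ (Fin n) => (1 + ‖x‖ ^ 2) ^ (-β))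
        = Set.univ := Set.eq_univ_of_forall fun x => (hp x).ne'
    rw [hs]
    exact isOpen_univ.measure_pos _ Set.univ_nonempty
  refine ⟨?_⟩
  rw [genCauchy, withDensity_apply _ MeasurableSet.univ, Measure.restrict_univ,
    ← ofReal_integral_eq_lintegral_ofReal (hi.const_mul _)
      (Eventually.of_forall fun x => by have := hp x; positivity),
    integral_const_mul]
  change ENNReal.ofReal (1 / cauchyZ n β * cauchyZ n β) = 1
  rw [one_div_mul_cancel hZ.ne', ENNReal.ofReal_one]

end

/-!
The measure `ν_β` is a Gaussian mixture: if `Z` is standard Gaussian on `ℝⁿ` and `G` is an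
independent Gamma variable of shape `a = β - n / 2` and rate `1 / 2`, then `X = G^{-1/2} Z` has law
`ν_β`, and `E[1 / G | X = x] = (1 + |x|²) / (2 (β - 1))`. Both facts are Tonelli computations with
the Gamma integral (`lintegral_genCauchy_eq_mixture`, `lintegral_mixture_div_eq`). The second one
is where the weight `1 + |x|²` and the factor `1 / (2 (β - 1))` come from.

Split `Var(g(X)) = E Var(g(X) | G) + Var(h(G))`, where `h(s) = E[g(s^{-1/2} Z)]`, and write
`D(s) = E[⟨∇g(x), x⟩]` and `A(s) = E|∇g(x)|² / s` with `x = s^{-1/2} Z`. Two inequalities are used.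

* The Gaussian Poincaré inequality with a quadratic gain,
  `Var(g(X) | G = s) ≤ A(s) - D(s)² / (2 n)`. In dimension one, it follows from the usual
  inequality for `f + t x²` by optimising over `t` (`variance_add_half_sq_le_gaussianReal`), and
  it tensorizes (`variance_add_half_sum_sq_le_gaussianPi`).
* The inequality `Var(h(G)) ≤ K E[(G h'(G))²]` with `K = 1 / (c (a - c))`, for any `0 < c ≤ 1` with
  `c < a` (`variance_le_gammaMeasure`). Since `s h'(s) = -D(s) / 2`, the right-hand side is
  `(K / 4) E[D(G)²]`.

The gain in the first inequality absorbs the second one: `Var(g(X)) ≤ C E[A(G)]` as soon as `1 ≤ C`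
and `K n / 2 ≤ C`. Taking `c = 1` for `n ≥ 3` and `c = 1 / 2` for `n ≤ 2`, these hold with
`C = C_β`, because `C_β ≥ 1 + 8 / (β - 1)` (`exists_gamma_exponent`).

Both one-dimensional inequalities come from one ground-state argument
(`integral_sq_sub_mul_le_of_hasDerivAt`). The Gaussian/Gamma argument is carried out for compactly
supported `g`; a smooth cutoff at scale `k` costs only a bounded term, since its gradient is of
order `1 / k` on `|x| ≤ 2 k`, which matches the weight (`poincare_of_hasCompactSupport`).
-/

/-! ### A ground-state inequality on the line -/

/-- The ground-state form of a weighted one-dimensional Poincaré inequality, on a compact interval.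
If `W' = -q p` with `q` increasing and vanishing at `z`, then `H = (f - f z)² W / q` satisfies
`H' ≤ f'² W / q' - (f - f z)² p`, the difference being `W / q'` times a square. As `H` is
nonpositive left of `z`, zero at `z` and nonnegative right of `z`, no decay of `W` at the ends is
needed. -/
theorem integral_sq_sub_mul_le_of_hasDerivAt {S : Set ℝ}
    {f f' p q q' W : ℝ → ℝ} {L z R : ℝ} (hLz : L < z) (hzR : z < R) (hS : Set.Icc L R ⊆ S)
    (hf : ∀ t ∈ S, HasDerivAt f (f' t) t) (hf' : ContinuousOn f' S)
    (hp : ContinuousOn p S)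
    (hq : ∀ t ∈ S, HasDerivAt q (q' t) t) (hq' : ContinuousOn q' S) (hq'pos : ∀ t ∈ S, 0 < q' t)
    (hqz : q z = 0) (hqneg : ∀ t ∈ S, t < z → q t < 0) (hqpos : ∀ t ∈ S, z < t → 0 < q t)
    (hW : ∀ t ∈ S, HasDerivAt W (-(q t * p t)) t) (hWpos : ∀ t ∈ S, 0 < W t) :
    0 ≤ ∫ t in Set.Ioc L R, (f' t ^ 2 * W t / q' t - (f t - f z) ^ 2 * p t) := by
  set φ : ℝ → ℝ := fun t => f' t ^ 2 * W t / q' t - (f t - f z) ^ 2 * p t with hφ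
  set H : ℝ → ℝ := fun t => (f t - f z) ^ 2 * W t / q t with hH
  have hLR : L ≤ R := (hLz.trans hzR).le
  have hzS : z ∈ S := hS ⟨hLz.le, hzR.le⟩
  have hfc : ContinuousOn f S := fun t ht => (hf t ht).continuousAt.continuousWithinAt
  have hWc : ContinuousOn W S := fun t ht => (hW t ht).continuousAt.continuousWithinAt
  have hφc : ContinuousOn φ S :=
    (((hf'.pow 2).mul hWc).div hq' fun t ht => (hq'pos t ht).ne').sub
      (((hfc.sub continuousOn_const).pow 2).mul hp)
  have hφi : IntegrableOn φ (Set.Icc L R) := (hφc.mono hS).integrableOn_Icc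
  have hHd : ∀ t ∈ S, q t ≠ 0 → ∃ d, HasDerivAt H d t ∧ d ≤ φ t := by
    intro t ht h0
    refine ⟨_, ((((hf t ht).sub_const (f z)).fun_pow 2).fun_mul (hW t ht)).fun_div (hq t ht) h0, ?_⟩
    have h1 := hq'pos t ht
    have h2 := hWpos t ht
    have key : φ t - ((((2 : ℕ) : ℝ) * (f t - f z) ^ (2 - 1) * f' t * W t
        + (f t - f z) ^ 2 * -(q t * p t)) * q t - (f t - f z) ^ 2 * W t * q' t) / q t ^ 2
        = W t / q' t * (f' t - (f t - f z) * q' t / q t) ^ 2 := by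
      simp only [hφ]
      push_cast
      field_simp
      ring
    have : 0 ≤ W t / q' t * (f' t - (f t - f z) * q' t / q t) ^ 2 := by positivity
    linarith
  have hHz : H z = 0 := by simp [hH]
  -- `H` has the junk value `0 / 0 = 0` at `z`, which is its limit there: both `f - f z` and `q`
  -- vanish to first order, and `f - f z` occurs squared.
  have hHcz : ContinuousAt H z := by
    have h1 := (hasDerivAt_iff_tendsto_slope.1 (hf z hzS))
    have h2 := (hasDerivAt_iff_tendsto_slope.1 (hq z hzS))
    have h3 : Tendsto (fun t => slope f z t / slope q z t * ((f t - f z) * W t)) (𝓝[≠] z)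
        (𝓝 (f' z / q' z * ((f z - f z) * W z))) :=
      (h1.div h2 (hq'pos z hzS).ne').mul
        ((((hf z hzS).continuousAt.sub continuousAt_const).mul
          (hW z hzS).continuousAt).tendsto.mono_left nhdsWithin_le_nhds)
    rw [continuousAt_iff_punctured_nhds, hHz]
    simp only [sub_self, zero_mul, mul_zero] at h3
    refine h3.congr' ?_
    filter_upwards [self_mem_nhdsWithin] with t ht
    have : t - z ≠ 0 := sub_ne_zero.2 ht
    simp only [slope_def_field, hqz, sub_zero, hH]
    rw [div_div_div_cancel_right₀ this]
    ring
  have hHc : ContinuousOn H (Set.Icc L R) := by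
    intro t ht
    by_cases h : t = z
    · subst h; exact hHcz.continuousWithinAt
    · have h0 : q t ≠ 0 := by
        rcases lt_or_gt_of_ne h with h | h
        · exact (hqneg t (hS ht) h).ne
        · exact (hqpos t (hS ht) h).ne'
      obtain ⟨d, hd, -⟩ := hHd t (hS ht) h0
      exact hd.continuousAt.continuousWithinAt
  have hd : ∀ t ∈ S, t ≠ z → HasDerivAt H (deriv H t) t ∧ deriv H t ≤ φ t := by
    intro t ht h
    have h0 : q t ≠ 0 := by
      rcases lt_or_gt_of_ne h with h | h
      · exact (hqneg t ht h).ne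
      · exact (hqpos t ht h).ne'
    obtain ⟨d, hd, hle⟩ := hHd t ht h0
    rw [hd.deriv]; exact ⟨hd, hle⟩
  have hR : H R - H z ≤ ∫ t in z..R, φ t :=
    intervalIntegral.sub_le_integral_of_hasDeriv_right_of_le hzR.le
      (hHc.mono (Set.Icc_subset_Icc_left hLz.le))
      (fun t ht => (hd t (hS ⟨hLz.le.trans ht.1.le, ht.2.le⟩) ht.1.ne').1.hasDerivWithinAt)
      (hφi.mono_set (Set.Icc_subset_Icc_left hLz.le))
      (fun t ht => (hd t (hS ⟨hLz.le.trans ht.1.le, ht.2.le⟩) ht.1.ne').2)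
  have hL : H z - H L ≤ ∫ t in L..z, φ t :=
    intervalIntegral.sub_le_integral_of_hasDeriv_right_of_le hLz.le
      (hHc.mono (Set.Icc_subset_Icc_right hzR.le))
      (fun t ht => (hd t (hS ⟨ht.1.le, ht.2.le.trans hzR.le⟩) ht.2.ne).1.hasDerivWithinAt)
      (hφi.mono_set (Set.Icc_subset_Icc_right hzR.le))
      (fun t ht => (hd t (hS ⟨ht.1.le, ht.2.le.trans hzR.le⟩) ht.2.ne).2)
  have hHR : 0 ≤ H R := by
    have := hqpos R (hS ⟨hLR, le_rfl⟩) hzR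
    have := hWpos R (hS ⟨hLR, le_rfl⟩)
    simp only [hH]; positivity
  have hHL : H L ≤ 0 := by
    have h1 := hqneg L (hS ⟨le_rfl, hLR⟩) hLz
    have h2 := hWpos L (hS ⟨le_rfl, hLR⟩)
    exact div_nonpos_of_nonneg_of_nonpos (by positivity) h1.le
  have hint : ∀ {u v}, L ≤ u → u ≤ v → v ≤ R → IntervalIntegrable φ volume u v := by
    intro u v hu huv hv
    rw [intervalIntegrable_iff_integrableOn_Icc_of_le huv]
    exact hφi.mono_set (Set.Icc_subset_Icc hu hv)
  rw [← intervalIntegral.integral_of_le hLR,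
    ← intervalIntegral.integral_add_adjacent_intervals (hint le_rfl hLz.le hzR.le)
      (hint hLz.le hzR.le le_rfl)]
  linarith

/-! ### The Gaussian measure on the line -/

theorem hasDerivAt_gaussianPDFReal_zero_one (x : ℝ) :
    HasDerivAt (gaussianPDFReal 0 1) (-(x * gaussianPDFReal 0 1 x)) x := by
  have h : HasDerivAt (fun x : ℝ => -(x - 0) ^ 2 / (2 * ((1 : NNReal) : ℝ))) (-x) x := by
    have := (((hasDerivAt_id' x).sub_const 0).fun_pow 2).fun_neg.div_const
      (2 * ((1 : NNReal) : ℝ))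
    refine this.congr_deriv ?_
    push_cast
    ring
  rw [gaussianPDFReal_def]
  refine (h.exp.const_mul ((√(2 * Real.pi * ((1 : NNReal) : ℝ)))⁻¹)).congr_deriv ?_
  ring

theorem integrable_gaussianReal_iff (f : ℝ → ℝ) :
    Integrable f (gaussianReal 0 1) ↔ Integrable fun x => f x * gaussianPDFReal 0 1 x := by
  rw [gaussianReal_of_var_ne_zero _ one_ne_zero,
    integrable_withDensity_iff (measurable_gaussianPDF 0 1)
      (Eventually.of_forall fun _ => gaussianPDF_lt_top)]
  simp [toReal_gaussianPDF]

theorem integral_gaussianReal_zero_one (f : ℝ → ℝ) :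
    ∫ x, f x ∂(gaussianReal 0 1) = ∫ x, f x * gaussianPDFReal 0 1 x := by
  rw [integral_gaussianReal_eq_integral_smul one_ne_zero]
  simp [mul_comm]

/-- The Gaussian Poincaré inequality on the line, centred at `f 0`: here `q x = x` and `W` is the
Gaussian density itself. -/
theorem integral_sq_sub_le_gaussianReal {f f' : ℝ → ℝ} (hf : ∀ x, HasDerivAt f (f' x) x)
    (hf' : Continuous f') (hi : Integrable (fun x => (f x - f 0) ^ 2) (gaussianReal 0 1))
    (hi' : Integrable (fun x => f' x ^ 2) (gaussianReal 0 1)) :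
    ∫ x, (f x - f 0) ^ 2 ∂(gaussianReal 0 1) ≤ ∫ x, f' x ^ 2 ∂(gaussianReal 0 1) := by
  rw [integrable_gaussianReal_iff] at hi hi'
  rw [integral_gaussianReal_zero_one, integral_gaussianReal_zero_one, ← sub_nonneg,
    ← integral_sub hi' hi]
  have hpc : Continuous (gaussianPDFReal 0 1) :=
    continuous_iff_continuousAt.2 fun x => (hasDerivAt_gaussianPDFReal_zero_one x).continuousAt
  have hcov : AECover volume atTop fun R : ℝ => Set.Ioc (-R) R :=
    aecover_Ioc tendsto_neg_atTop_atBot tendsto_id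
  refine ge_of_tendsto (hcov.integral_tendsto_of_countably_generated (hi'.sub hi)) ?_
  filter_upwards [eventually_gt_atTop 0] with R hR
  have := integral_sq_sub_mul_le_of_hasDerivAt (S := Set.univ) (L := -R) (z := 0) (R := R)
    (q := id) (q' := fun _ => 1) (p := gaussianPDFReal 0 1) (W := gaussianPDFReal 0 1)
    (by linarith) hR (Set.subset_univ _)
    (fun t _ => hf t) hf'.continuousOn hpc.continuousOn (fun t _ => hasDerivAt_id t)
    continuousOn_const (fun _ _ => one_pos) rfl (fun t _ h => h) (fun t _ h => h)
    (fun t _ => hasDerivAt_gaussianPDFReal_zero_one t)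
    (fun t _ => gaussianPDFReal_pos 0 1 t one_ne_zero)
  simpa using this

theorem integrable_pow_gaussianReal (k : ℕ) :
    Integrable (fun x : ℝ => x ^ k) (gaussianReal 0 1) := by
  have h := (memLp_id_gaussianReal (μ := 0) (v := 1) (k : NNReal)).integrable_norm_pow'
  refine h.mono' (by fun_prop) (Eventually.of_forall fun x => ?_)
  simp

/-- Gaussian integration by parts. -/
theorem integral_mul_gaussianReal_eq_integral_deriv {f f' : ℝ → ℝ}
    (hf : ∀ x, HasDerivAt f (f' x) x)
    (hi : Integrable f (gaussianReal 0 1)) (hi' : Integrable f' (gaussianReal 0 1))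
    (hxi : Integrable (fun x => x * f x) (gaussianReal 0 1)) :
    ∫ x, x * f x ∂(gaussianReal 0 1) = ∫ x, f' x ∂(gaussianReal 0 1) := by
  rw [integrable_gaussianReal_iff] at hi hi' hxi
  rw [integral_gaussianReal_zero_one, integral_gaussianReal_zero_one, eq_comm, ← sub_eq_zero,
    ← integral_sub hi' hxi]
  refine integral_eq_zero_of_hasDerivAt_of_integrable
    (f := fun x => f x * gaussianPDFReal 0 1 x) (fun x => ?_) (hi'.sub hxi) hi
  refine ((hf x).fun_mul (hasDerivAt_gaussianPDFReal_zero_one x)).congr_deriv ?_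
  ring

theorem integral_sq_gaussianReal : ∫ x, x ^ 2 ∂(gaussianReal 0 1) = 1 := by
  have h := integral_mul_gaussianReal_eq_integral_deriv (f := fun x => x) (f' := fun _ => 1)
    hasDerivAt_id' (by simpa using integrable_pow_gaussianReal 1) (integrable_const _)
    (by simpa [sq] using integrable_pow_gaussianReal 2)
  simpa [sq] using h

theorem integral_pow_four_gaussianReal : ∫ x, x ^ 4 ∂(gaussianReal 0 1) = 3 := by
  have h := integral_mul_gaussianReal_eq_integral_deriv (f := fun x => x ^ 3)
    (f' := fun x => 3 * x ^ 2) (fun x => by simpa using hasDerivAt_pow 3 x)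
    (integrable_pow_gaussianReal 3) ((integrable_pow_gaussianReal 2).const_mul 3)
    ((integrable_pow_gaussianReal 4).congr (Eventually.of_forall fun x => by simp; ring))
  rw [integral_const_mul, integral_sq_gaussianReal] at h
  rw [mul_one] at h
  rw [← h]
  exact integral_congr_ae (Eventually.of_forall fun x => by simp; ring)

/-- The Gaussian Poincaré inequality with a gain coming from the second Hermite polynomial, whose
eigenvalue is `2` rather than `1`. -/
theorem variance_add_half_sq_le_gaussianReal {f f' : ℝ → ℝ} {M M' : ℝ}
    (hf : ∀ x, HasDerivAt f (f' x) x) (hf' : Continuous f')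
    (hM : ∀ x, |f x| ≤ M) (hM' : ∀ x, |f' x| ≤ M') :
    ∫ x, f x ^ 2 ∂(gaussianReal 0 1) - (∫ x, f x ∂(gaussianReal 0 1)) ^ 2 ≤
      ∫ x, f' x ^ 2 ∂(gaussianReal 0 1) - 1 / 2 * (∫ x, x * f' x ∂(gaussianReal 0 1)) ^ 2 := by
  set γ := gaussianReal 0 1
  have hfc : Continuous f := continuous_iff_continuousAt.2 fun x => (hf x).continuousAt
  have hbd : ∀ (k : ℕ) {u : ℝ → ℝ} {B : ℝ}, Continuous u → (∀ x, |u x| ≤ B) →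
      Integrable (fun x => x ^ k * u x) γ := fun k u B hu hB =>
    (integrable_pow_gaussianReal k).mul_bdd (c := B) hu.aestronglyMeasurable
      (Eventually.of_forall hB)
  have hbd2 : ∀ {u : ℝ → ℝ} {B : ℝ}, (∀ x, |u x| ≤ B) → ∀ x, |u x ^ 2| ≤ B ^ 2 := by
    intro u B h x
    rw [abs_pow]; exact pow_le_pow_left₀ (abs_nonneg _) (h x) 2
  have i0 := hbd 0 hfc hM
  have i1 := hbd 1 hfc hM
  have i2 := hbd 2 hfc hM
  have j1 := hbd 1 hf' hM'
  have s0 := hbd 0 (hfc.pow 2) (hbd2 hM)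
  have t0 := hbd 0 (hf'.pow 2) (hbd2 hM')
  simp only [pow_zero, one_mul, pow_one, Pi.pow_apply] at i0 i1 j1 s0 t0
  have m2 := integrable_pow_gaussianReal 2
  have m4 := integrable_pow_gaussianReal 4
  have hibp : ∫ x, x * f' x ∂γ = ∫ x, x ^ 2 * f x ∂γ - ∫ x, f x ∂γ := by
    have h := integral_mul_gaussianReal_eq_integral_deriv (f := fun x => x * f x)
      (f' := fun x => f x + x * f' x)
      (fun x => by simpa using (hasDerivAt_id' x).fun_mul (hf x)) i1 (i0.add j1)
      (i2.congr (Eventually.of_forall fun x => by simp; ring))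
    rw [integral_add i0 j1] at h
    rw [eq_sub_iff_add_eq, add_comm, ← h]
    exact integral_congr_ae (Eventually.of_forall fun x => by simp; ring)
  -- The Poincaré inequality for `f + t x²`, expanded as a quadratic polynomial in `t`.
  have key : ∀ t : ℝ, 0 ≤ (∫ x, f' x ^ 2 ∂γ - (∫ x, f x ^ 2 ∂γ - (∫ x, f x ∂γ) ^ 2))
      + 2 * t * ∫ x, x * f' x ∂γ + 2 * t ^ 2 := by
    intro t
    set c := f 0
    have e1 : (fun x => (f x + t * x ^ 2 - (f 0 + t * 0 ^ 2)) ^ 2) = fun x =>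
        f x ^ 2 + (2 * t) * (x ^ 2 * f x) + (t ^ 2) * x ^ 4 + (-2 * c) * f x
          + (-2 * c * t) * x ^ 2 + c ^ 2 := by
      funext x; simp only [c]; ring
    have e2 : (fun x => (f' x + t * (2 * x)) ^ 2) = fun x =>
        f' x ^ 2 + (4 * t) * (x * f' x) + (4 * t ^ 2) * x ^ 2 := by
      funext x; ring
    have h := integral_sq_sub_le_gaussianReal (f := fun x => f x + t * x ^ 2)
      (f' := fun x => f' x + t * (2 * x))
      (fun x => by simpa using (hf x).fun_add ((hasDerivAt_pow 2 x).const_mul t))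
      (by fun_prop)
      (by
        rw [e1]
        exact ((((s0.add (i2.const_mul _)).add (m4.const_mul _)).add (i0.const_mul _)).add
          (m2.const_mul _)).add (integrable_const _))
      (by
        rw [e2]
        exact (t0.add (j1.const_mul _)).add (m2.const_mul _))
    rw [e1, e2, integral_add, integral_add, integral_add, integral_add, integral_add,
      integral_add, integral_add] at h
    · simp only [integral_const_mul, integral_const, smul_eq_mul, integral_sq_gaussianReal,
        integral_pow_four_gaussianReal, probReal_univ] at h
      rw [hibp] at h ⊢
      nlinarith [sq_nonneg (∫ x, f x ∂γ + t - c)]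
    all_goals first
      | exact t0
      | exact s0
      | exact j1.const_mul _
      | exact m2.const_mul _
      | exact m4.const_mul _
      | exact i0.const_mul _
      | exact i2.const_mul _
      | exact integrable_const _
      | exact t0.add (j1.const_mul _)
      | exact s0.add (i2.const_mul _)
      | exact (s0.add (i2.const_mul _)).add (m4.const_mul _)
      | exact ((s0.add (i2.const_mul _)).add (m4.const_mul _)).add (i0.const_mul _)
      | exact (((s0.add (i2.const_mul _)).add (m4.const_mul _)).add (i0.const_mul _)).add
          (m2.const_mul _)
  -- The minimum of that polynomial.
  have := key (-(1 / 2) * ∫ x, x * f' x ∂γ)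
  nlinarith

/-! ### The Gamma distribution -/

theorem gammaMeasure_eq_restrict_withDensity (a r : ℝ) :
    gammaMeasure a r = (volume.restrict (Set.Ioi 0)).withDensity (gammaPDF a r) := by
  have h : (volume.restrict (Set.Ici (0 : ℝ))).withDensity (gammaPDF a r) = gammaMeasure a r := by
    rw [gammaMeasure, ← withDensity_indicator measurableSet_Ici]
    congr 1
    funext x
    by_cases hx : 0 ≤ x
    · rw [Set.indicator_of_mem (Set.mem_Ici.2 hx)]
    · rw [Set.indicator_of_notMem (by simpa using hx), gammaPDF_of_neg (not_le.1 hx)]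
  rw [← h, Measure.restrict_congr_set Ioi_ae_eq_Ici]

theorem ae_pos_gammaMeasure (a r : ℝ) : ∀ᵐ s ∂(gammaMeasure a r), 0 < s := by
  rw [gammaMeasure_eq_restrict_withDensity]
  exact (withDensity_absolutelyContinuous _ _).ae_le (ae_restrict_mem measurableSet_Ioi)

theorem measurable_gammaPDF (a r : ℝ) : Measurable (gammaPDF a r) :=
  (measurable_gammaPDFReal a r).ennreal_ofReal

theorem toReal_gammaPDF {a r : ℝ} (ha : 0 < a) (hr : 0 < r) (x : ℝ) :
    (gammaPDF a r x).toReal = gammaPDFReal a r x :=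
  ENNReal.toReal_ofReal (gammaPDFReal_nonneg ha hr x)

theorem integrable_gammaMeasure_iff {a r : ℝ} (ha : 0 < a) (hr : 0 < r) (f : ℝ → ℝ) :
    Integrable f (gammaMeasure a r) ↔
      IntegrableOn (fun x => f x * gammaPDFReal a r x) (Set.Ioi 0) := by
  rw [gammaMeasure_eq_restrict_withDensity, integrable_withDensity_iff (measurable_gammaPDF a r)
      (Eventually.of_forall fun _ => ENNReal.ofReal_lt_top)]
  simp [toReal_gammaPDF ha hr, IntegrableOn]

theorem integral_gammaMeasure {a r : ℝ} (ha : 0 < a) (hr : 0 < r) (f : ℝ → ℝ) :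
    ∫ x, f x ∂(gammaMeasure a r) = ∫ x in Set.Ioi 0, f x * gammaPDFReal a r x := by
  rw [gammaMeasure_eq_restrict_withDensity,
    integral_withDensity_eq_integral_toReal_smul (measurable_gammaPDF a r)
      (Eventually.of_forall fun _ => ENNReal.ofReal_lt_top)]
  simp [toReal_gammaPDF ha hr, mul_comm]

theorem integrable_gammaMeasure_of_continuousOn {a r : ℝ} (ha : 0 < a) (hr : 0 < r) {f : ℝ → ℝ}
    {M : ℝ} (hf : ContinuousOn f (Set.Ioi 0)) (hM : ∀ s, 0 < s → |f s| ≤ M) :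
    Integrable f (gammaMeasure a r) := by
  have := isProbabilityMeasure_gammaMeasure ha hr
  refine Integrable.of_bound (C := M) ?_ ?_
  · rw [gammaMeasure_eq_restrict_withDensity]
    exact (hf.aestronglyMeasurable measurableSet_Ioi).mono_ac (withDensity_absolutelyContinuous _ _)
  · filter_upwards [ae_pos_gammaMeasure a r] with s hs using hM s hs

/-- A weighted Poincaré inequality for the Gamma distribution, with weight `s²` in place of the
weight `s` of the Laguerre operator. The constant is the best one for `c = 1` and `a > 2`, where
`1 / s` is an eigenfunction; smaller values of `c` are needed when `a` is close to `1` or below. -/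
theorem variance_le_gammaMeasure {a c : ℝ} (hc : 0 < c) (hca : c < a) (hc1 : c ≤ 1)
    {h h' : ℝ → ℝ} {M M' : ℝ} (hh : ∀ s, 0 < s → HasDerivAt h (h' s) s)
    (hh' : ContinuousOn h' (Set.Ioi 0)) (hM : ∀ s, 0 < s → |h s| ≤ M)
    (hM' : ∀ s, 0 < s → |s * h' s| ≤ M') :
    ∫ s, h s ^ 2 ∂(gammaMeasure a (1 / 2)) - (∫ s, h s ∂(gammaMeasure a (1 / 2))) ^ 2 ≤
      1 / (c * (a - c)) * ∫ s, (s * h' s) ^ 2 ∂(gammaMeasure a (1 / 2)) := by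
  have ha : 0 < a := hc.trans hca
  have h2 : (0 : ℝ) < 1 / 2 := by norm_num
  have hac : 0 < a - c := sub_pos.2 hca
  have := isProbabilityMeasure_gammaMeasure ha h2
  set γ := gammaMeasure a (1 / 2) with hγ
  set C : ℝ := (1 / 2) ^ a / Real.Gamma a with hC
  have hCpos : 0 < C := div_pos (by positivity) (Real.Gamma_pos_of_pos ha)
  set p : ℝ → ℝ := gammaPDFReal a (1 / 2) with hp
  have hpeq : ∀ t, 0 < t → p t = C * t ^ (a - 1) * Real.exp (-(1 / 2 * t)) := by
    intro t ht
    simp only [hp, gammaPDFReal, if_pos ht.le, hC]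
  -- With `p` the density, `W = s^{1-c} p` up to the constant, and `q = -W' / p` vanishes
  -- exactly at `z = 2 (a - c)`.
  set q : ℝ → ℝ := fun t => 1 / 2 * t ^ (1 - c) - (a - c) * t ^ (-c) with hq
  set q' : ℝ → ℝ := fun t => (1 - c) / 2 * t ^ (-c) + c * (a - c) * t ^ (-c - 1) with hq'
  set W : ℝ → ℝ := fun t => C * t ^ (a - c) * Real.exp (-(1 / 2 * t)) with hW
  set z : ℝ := 2 * (a - c) with hz
  have hz0 : 0 < z := by positivity
  have hhc : ContinuousOn h (Set.Ioi 0) := fun s hs =>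
    (hh s hs).continuousAt.continuousWithinAt
  have hqeq : ∀ t, 0 < t → q t = t ^ (-c) * ((t - z) / 2) := by
    intro t ht
    have : t ^ (1 - c) = t ^ (-c) * t := by
      rw [show 1 - c = -c + 1 by ring, Real.rpow_add_one ht.ne']
    simp only [hq, hz, this]; ring
  have hpc : ContinuousOn p (Set.Ioi 0) := by
    have : ContinuousOn (fun t : ℝ => C * t ^ (a - 1) * Real.exp (-(1 / 2 * t))) (Set.Ioi 0) :=
      (continuousOn_const.mul
        (continuousOn_id.rpow_const fun t ht => Or.inl (ne_of_gt ht))).mul (by fun_prop)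
    exact this.congr fun t ht => hpeq t ht
  have hqd : ∀ t ∈ Set.Ioi (0 : ℝ), HasDerivAt q (q' t) t := by
    intro t ht
    have e1 := (Real.hasDerivAt_rpow_const (p := 1 - c) (Or.inl (ne_of_gt ht))).const_mul
      (1 / 2 : ℝ)
    have e2 := (Real.hasDerivAt_rpow_const (p := -c) (Or.inl (ne_of_gt ht))).const_mul (a - c)
    refine (e1.fun_sub e2).congr_deriv ?_
    rw [show 1 - c - 1 = -c by ring]
    simp only [hq']; ring
  have hq'c : ContinuousOn q' (Set.Ioi 0) :=
    (continuousOn_const.mul (continuousOn_id.rpow_const fun t ht => Or.inl (ne_of_gt ht))).add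
      (continuousOn_const.mul (continuousOn_id.rpow_const fun t ht => Or.inl (ne_of_gt ht)))
  have hq'ge : ∀ t ∈ Set.Ioi (0 : ℝ), c * (a - c) * t ^ (-c - 1) ≤ q' t := by
    intro t ht
    have h1 : 0 < t ^ (-c) := Real.rpow_pos_of_pos ht _
    have h2 : 0 ≤ (1 - c) / 2 := by linarith
    simp only [hq']
    have := mul_nonneg h2 h1.le
    linarith
  have hlow : ∀ t ∈ Set.Ioi (0 : ℝ), 0 < c * (a - c) * t ^ (-c - 1) := fun t ht =>
    mul_pos (mul_pos hc hac) (Real.rpow_pos_of_pos ht _)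
  have hq'pos : ∀ t ∈ Set.Ioi (0 : ℝ), 0 < q' t := fun t ht => (hlow t ht).trans_le (hq'ge t ht)
  have hWpos : ∀ t ∈ Set.Ioi (0 : ℝ), 0 < W t := fun t ht =>
    mul_pos (mul_pos hCpos (Real.rpow_pos_of_pos ht _)) (Real.exp_pos _)
  have hWd : ∀ t ∈ Set.Ioi (0 : ℝ), HasDerivAt W (-(q t * p t)) t := by
    intro t ht
    have e1 := (Real.hasDerivAt_rpow_const (p := a - c) (Or.inl (ne_of_gt ht))).const_mul C
    have e2 := ((hasDerivAt_id' t).const_mul (1 / 2 : ℝ)).fun_neg.exp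
    refine (e1.fun_mul e2).congr_deriv ?_
    have r1 : t ^ (a - c) = t ^ (-c) * t ^ (a - 1) * t := by
      rw [← Real.rpow_add ht, ← Real.rpow_add_one (ne_of_gt ht)]; congr 1; ring
    have r2 : t ^ (a - c - 1) = t ^ (-c) * t ^ (a - 1) := by
      rw [← Real.rpow_add ht]; congr 1; ring
    rw [hqeq t ht, hpeq t ht, r1, r2]
    simp only [hz]; ring
  have hWle : ∀ t ∈ Set.Ioi (0 : ℝ), W t / q' t ≤ 1 / (c * (a - c)) * t ^ 2 * p t := by
    intro t ht
    refine (div_le_div_of_nonneg_left (hWpos t ht).le (hlow t ht) (hq'ge t ht)).trans (le_of_eq ?_)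
    rw [hpeq t ht, div_eq_iff (hlow t ht).ne']
    have r1 : t ^ (a - c) = t ^ 2 * t ^ (a - 1) * t ^ (-c - 1) := by
      rw [← Real.rpow_natCast, ← Real.rpow_add ht, ← Real.rpow_add ht]; congr 1; push_cast; ring
    simp only [hW, r1]
    field_simp
  have ih : Integrable h γ := integrable_gammaMeasure_of_continuousOn ha h2 hhc hM
  have ih2 : Integrable (fun s => h s ^ 2) γ :=
    integrable_gammaMeasure_of_continuousOn ha h2 (M := M ^ 2) (hhc.pow 2) fun s hs => by
      rw [abs_pow]; exact pow_le_pow_left₀ (abs_nonneg _) (hM s hs) 2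
  have ihu : Integrable (fun s => (h s - h z) ^ 2) γ := by
    have : (fun s => (h s - h z) ^ 2) = fun s => h s ^ 2 - 2 * h z * h s + h z ^ 2 := by
      funext s; ring
    rw [this]
    exact (ih2.sub (ih.const_mul _)).add (integrable_const _)
  have ih' : Integrable (fun s => (s * h' s) ^ 2) γ :=
    integrable_gammaMeasure_of_continuousOn ha h2 (M := M' ^ 2)
      ((continuousOn_id.mul hh').pow 2) fun s hs => by
        rw [abs_pow]; exact pow_le_pow_left₀ (abs_nonneg _) (hM' s hs) 2
  have key : ∫ s, (h s - h z) ^ 2 ∂γ ≤ 1 / (c * (a - c)) * ∫ s, (s * h' s) ^ 2 ∂γ := by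
    rw [← integral_const_mul]
    have jh' := ih'.const_mul (1 / (c * (a - c)))
    rw [hγ, integrable_gammaMeasure_iff ha h2] at jh' ihu
    rw [integral_gammaMeasure ha h2, integral_gammaMeasure ha h2, ← sub_nonneg,
      ← integral_sub jh' ihu]
    have hcov : AECover (volume.restrict (Set.Ioi (0 : ℝ))) atTop
        fun R : ℝ => Set.Icc R⁻¹ R :=
      (aecover_Ioi_of_Ici tendsto_inv_atTop_zero).inter
        ((aecover_Iic tendsto_id).restrict)
    refine ge_of_tendsto (hcov.integral_tendsto_of_countably_generated (jh'.sub ihu)) ?_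
    filter_upwards [eventually_gt_atTop 0, eventually_gt_atTop z,
      eventually_gt_atTop z⁻¹] with R hR hRz hRz'
    have hRz'' : R⁻¹ < z := inv_lt_of_inv_lt₀ hz0 hRz'
    have hsub : Set.Icc R⁻¹ R ⊆ Set.Ioi 0 := fun t ht => (inv_pos.2 hR).trans_le ht.1
    have main := integral_sq_sub_mul_le_of_hasDerivAt (S := Set.Ioi 0) (L := R⁻¹) (z := z) (R := R)
      hRz'' hRz hsub (f := h) (f' := h') (p := p) (q := q) (q' := q') (W := W)
      (fun t ht => hh t ht) hh' hpc hqd hq'c hq'pos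
      (by rw [hqeq z hz0]; simp)
      (fun t ht hlt => by
        rw [hqeq t ht]
        exact mul_neg_of_pos_of_neg (Real.rpow_pos_of_pos ht _) (by linarith))
      (fun t ht hlt => by
        rw [hqeq t ht]
        exact mul_pos (Real.rpow_pos_of_pos ht _) (by linarith))
      hWd hWpos
    rw [Measure.restrict_restrict measurableSet_Icc, Set.inter_eq_left.2 hsub,
      integral_Icc_eq_integral_Ioc]
    have hWc : ContinuousOn W (Set.Ioi 0) := fun t ht =>
      (hWd t ht).continuousAt.continuousWithinAt
    refine main.trans (setIntegral_mono_on ?_ ?_ measurableSet_Ioc fun t ht => ?_)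
    · refine (ContinuousOn.integrableOn_Icc ?_).mono_set Set.Ioc_subset_Icc_self
      exact ((((hh'.pow 2).mul hWc).div hq'c fun t ht => (hq'pos t ht).ne').sub
        (((hhc.sub continuousOn_const).pow 2).mul hpc)).mono hsub
    · exact (jh'.sub ihu).mono_set (Set.Ioc_subset_Icc_self.trans hsub)
    · have ht0 : t ∈ Set.Ioi (0 : ℝ) := hsub (Set.Ioc_subset_Icc_self ht)
      have := mul_le_mul_of_nonneg_left (hWle t ht0) (sq_nonneg (h' t))
      refine sub_le_sub_right ?_ _
      calc h' t ^ 2 * W t / q' t = h' t ^ 2 * (W t / q' t) := by ring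
        _ ≤ _ := this
        _ = _ := by ring
  have hexp : ∫ s, (h s - h z) ^ 2 ∂γ
      = ∫ s, h s ^ 2 ∂γ - 2 * h z * ∫ s, h s ∂γ + h z ^ 2 := by
    have : (fun s => (h s - h z) ^ 2) = fun s => h s ^ 2 - 2 * h z * h s + h z ^ 2 := by
      funext s; ring
    have i1 : Integrable (fun s => h s ^ 2 - 2 * h z * h s) γ := ih2.sub (ih.const_mul _)
    rw [this, integral_add i1 (integrable_const _), integral_sub ih2 (ih.const_mul _),
      integral_const_mul]
    simp
  rw [hexp] at key
  nlinarith [sq_nonneg (∫ s, h s ∂γ - h z)]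

/-! ### The Gaussian measure in dimension `n` -/

/-- The standard Gaussian measure on `Fin n → ℝ`. -/
noncomputable abbrev gaussianPi (n : ℕ) : Measure (Fin n → ℝ) :=
  Measure.pi fun _ => gaussianReal 0 1

theorem sq_integral_le_integral_sq {Ω : Type*} [MeasurableSpace Ω] {μ : Measure Ω}
    [IsProbabilityMeasure μ] {u : Ω → ℝ} (hu : Integrable u μ)
    (hu2 : Integrable (fun x => u x ^ 2) μ) :
    (∫ x, u x ∂μ) ^ 2 ≤ ∫ x, u x ^ 2 ∂μ := by
  set c := ∫ x, u x ∂μ with hc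
  have h0 : 0 ≤ ∫ x, (u x - c) ^ 2 ∂μ := integral_nonneg fun _ => sq_nonneg _
  have e : (fun x => (u x - c) ^ 2) = fun x => u x ^ 2 - 2 * c * u x + c ^ 2 := by
    funext x; ring
  have i1 : Integrable (fun x => u x ^ 2 - 2 * c * u x) μ := hu2.sub (hu.const_mul _)
  rw [e, integral_add i1 (integrable_const _), integral_sub hu2 (hu.const_mul _),
    integral_const_mul, ← hc] at h0
  simp only [integral_const, probReal_univ, smul_eq_mul, one_mul] at h0
  linarith

theorem measurePreserving_cons_gaussianPi (n : ℕ) :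
    MeasurePreserving (fun p : ℝ × (Fin n → ℝ) => (Fin.cons p.1 p.2 : Fin (n + 1) → ℝ))
      ((gaussianReal 0 1).prod (gaussianPi n)) (gaussianPi (n + 1)) := by
  have h := (measurePreserving_piFinSuccAbove
    (fun _ : Fin (n + 1) => gaussianReal 0 1) 0).symm
  convert h using 1
  funext p
  exact (Fin.insertNth_zero' p.1 p.2).symm

theorem integral_gaussianPi_succ {n : ℕ} {φ : (Fin (n + 1) → ℝ) → ℝ}
    (hφ : Integrable φ (gaussianPi (n + 1))) :
    ∫ z, φ z ∂(gaussianPi (n + 1)) =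
      ∫ y, ∫ x, φ (Fin.cons x y) ∂(gaussianReal 0 1) ∂(gaussianPi n) := by
  have h := measurePreserving_cons_gaussianPi n
  rw [← h.map_eq, integral_map h.measurable.aemeasurable (h.map_eq ▸ hφ.aestronglyMeasurable)]
  exact integral_prod_symm _ ((h.integrable_comp hφ.aestronglyMeasurable).2 hφ)

theorem integrable_eval_gaussianPi {n : ℕ} (i : Fin n) :
    Integrable (fun z : Fin n → ℝ => z i) (gaussianPi n) := by
  have h := measurePreserving_eval (fun _ : Fin n => gaussianReal 0 1) i
  exact (h.integrable_comp (g := fun x : ℝ => x) (by fun_prop)).2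
    (by simpa using integrable_pow_gaussianReal 1)

/-- Tensorized Gaussian Poincaré inequality with quadratic gain. Only partial derivatives enter, so
that the hypotheses pass to averages over one coordinate; the right-hand side passes to them by
Jensen's inequality. -/
theorem variance_add_half_sum_sq_le_gaussianPi (n : ℕ) : ∀ {f : (Fin n → ℝ) → ℝ}
    {f' : Fin n → (Fin n → ℝ) → ℝ} {M M' : ℝ}, Continuous f → (∀ i, Continuous (f' i)) →
    (∀ z, |f z| ≤ M) → (∀ i z, |f' i z| ≤ M') →
    (∀ i z, HasDerivAt (fun t => f (Function.update z i t)) (f' i z) (z i)) →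
    ∫ z, f z ^ 2 ∂(gaussianPi n) - (∫ z, f z ∂(gaussianPi n)) ^ 2 ≤
      ∑ i, (∫ z, f' i z ^ 2 ∂(gaussianPi n) - 1 / 2 * (∫ z, z i * f' i z ∂(gaussianPi n)) ^ 2) := by
  induction n with
  | zero =>
    intro f f' M M' _ _ _ _ _
    have : f = fun _ => f default := funext fun z => by rw [Subsingleton.elim z default]
    rw [this]
    simp
  | succ n ih =>
    intro f f' M M' hf hf' hM hM' hd
    have bd {k : ℕ} {u : (Fin k → ℝ) → ℝ} {B : ℝ} (hu : Continuous u) (hB : ∀ z, |u z| ≤ B) :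
        Integrable u (gaussianPi k) :=
      Integrable.of_bound (C := B) hu.aestronglyMeasurable (Eventually.of_forall hB)
    have bd1 {u : ℝ → ℝ} {B : ℝ} (hu : Continuous u) (hB : ∀ z, |u z| ≤ B) :
        Integrable u (gaussianReal 0 1) :=
      Integrable.of_bound (C := B) hu.aestronglyMeasurable (Eventually.of_forall hB)
    have sqb : ∀ {α : Type} {u : α → ℝ} {B : ℝ}, (∀ z, |u z| ≤ B) → ∀ z, |u z ^ 2| ≤ B ^ 2 :=
      fun {α u B} h z => by rw [abs_pow]; exact pow_le_pow_left₀ (abs_nonneg _) (h z) 2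
    have mb {k : ℕ} {u : (Fin k → ℝ) → ℝ} {B : ℝ} (i : Fin k) (hu : Continuous u)
        (hB : ∀ z, |u z| ≤ B) : Integrable (fun z => z i * u z) (gaussianPi k) :=
      (integrable_eval_gaussianPi i).mul_bdd (c := B) hu.aestronglyMeasurable
        (Eventually.of_forall hB)
    -- averaging over the first coordinate preserves continuity and bounds
    have avc {u : (Fin (n + 1) → ℝ) → ℝ} {B : ℝ} (hu : Continuous u) (hB : ∀ z, |u z| ≤ B) :
        Continuous fun y : Fin n → ℝ => ∫ x, u (Fin.cons x y) ∂(gaussianReal 0 1) :=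
      continuous_of_dominated (bound := fun _ => B)
        (fun y => (by fun_prop : Continuous fun x : ℝ =>
          u (Fin.cons x y)).aestronglyMeasurable)
        (fun y => Eventually.of_forall fun x => hB _) (integrable_const _)
        (Eventually.of_forall fun x => by fun_prop)
    have avb {u : (Fin (n + 1) → ℝ) → ℝ} {B : ℝ} (hB : ∀ z, |u z| ≤ B) (y : Fin n → ℝ) :
        |∫ x, u (Fin.cons x y) ∂(gaussianReal 0 1)| ≤ B := by
      have := norm_integral_le_of_norm_le_const (μ := gaussianReal 0 1) (C := B)
        (f := fun x => u (Fin.cons x y)) (Eventually.of_forall fun x => hB _)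
      simpa using this
    set F : (Fin n → ℝ) → ℝ := fun y => ∫ x, f (Fin.cons x y) ∂(gaussianReal 0 1) with hF
    set F' : Fin n → (Fin n → ℝ) → ℝ :=
      fun i y => ∫ x, f' i.succ (Fin.cons x y) ∂(gaussianReal 0 1) with hF'
    set d : (Fin n → ℝ) → ℝ := fun y => ∫ x, x * f' 0 (Fin.cons x y) ∂(gaussianReal 0 1) with hdd
    have hFd : ∀ i y, HasDerivAt (fun t => F (Function.update y i t)) (F' i y) (y i) := by
      intro i y
      have h := (hasDerivAt_integral_of_dominated_loc_of_deriv_le (μ := gaussianReal 0 1)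
        (F := fun t x => f (Fin.cons x (Function.update y i t)))
        (F' := fun t x => f' i.succ (Fin.cons x (Function.update y i t)))
        (x₀ := y i) (bound := fun _ => M') univ_mem
        (Eventually.of_forall fun t => (by fun_prop : Continuous fun x : ℝ =>
          f (Fin.cons x (Function.update y i t))).aestronglyMeasurable)
        (bd1 (by fun_prop) fun x => hM _)
        (by
          have := hf' i.succ
          exact (by fun_prop : Continuous fun x : ℝ =>
            f' i.succ (Fin.cons x (Function.update y i (y i)))).aestronglyMeasurable)
        (Eventually.of_forall fun x t _ => hM' _ _) (integrable_const _)
        (Eventually.of_forall fun x t _ => by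
          have := hd i.succ (Fin.cons x (Function.update y i t))
          simpa [← Fin.cons_update] using this)).2
      simpa [hF, hF'] using h
    -- Induction hypothesis for the average `F` over the first coordinate, and the one-dimensional
    -- inequality in the first coordinate for the remaining conditional variance.
    have hIH := ih (f := F) (f' := F') (avc hf hM) (fun i => avc (hf' i.succ) (hM' i.succ))
      (avb hM) (fun i => avb (hM' i.succ)) hFd
    have h1 : ∀ y, ∫ x, f (Fin.cons x y) ^ 2 ∂(gaussianReal 0 1) - F y ^ 2 ≤
        ∫ x, f' 0 (Fin.cons x y) ^ 2 ∂(gaussianReal 0 1) - 1 / 2 * d y ^ 2 := by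
      intro y
      have := hf' 0
      refine variance_add_half_sq_le_gaussianReal (f := fun x => f (Fin.cons x y))
        (f' := fun x => f' 0 (Fin.cons x y)) (fun x => ?_) (by fun_prop) (fun x => hM _)
        (fun x => hM' _ _)
      have := hd 0 (Fin.cons x y)
      simpa using this
    have hdc : Continuous d := by
      have := hf' 0
      refine continuous_of_dominated (bound := fun x => M' * |x|)
        (fun y => (by fun_prop : Continuous fun x : ℝ =>
          x * f' 0 (Fin.cons x y)).aestronglyMeasurable)
        (fun y => Eventually.of_forall fun x => ?_) ?_
        (Eventually.of_forall fun x => by fun_prop)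
      · rw [norm_mul, mul_comm]
        exact mul_le_mul_of_nonneg_right (hM' _ _) (abs_nonneg _)
      · exact ((by simpa using integrable_pow_gaussianReal 1 :
          Integrable (fun x : ℝ => x) (gaussianReal 0 1)).abs).const_mul _
    have hdb : ∀ y, |d y| ≤ ∫ x, M' * |x| ∂(gaussianReal 0 1) := by
      intro y
      refine norm_integral_le_of_norm_le (f := fun x => x * f' 0 (Fin.cons x y)) ?_
        (Eventually.of_forall fun x => ?_)
      · exact ((by simpa using integrable_pow_gaussianReal 1 :
          Integrable (fun x : ℝ => x) (gaussianReal 0 1)).abs).const_mul _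
      · rw [norm_mul, mul_comm]
        exact mul_le_mul_of_nonneg_right (hM' _ _) (abs_nonneg _)
    have if2 : Integrable (fun y => ∫ x, f (Fin.cons x y) ^ 2 ∂(gaussianReal 0 1)) (gaussianPi n) :=
      bd (avc (u := fun z => f z ^ 2) (hf.pow 2) (sqb hM)) (avb (u := fun z => f z ^ 2) (sqb hM))
    have iF2 : Integrable (fun y => F y ^ 2) (gaussianPi n) :=
      bd ((avc hf hM).pow 2) (sqb (avb hM))
    have ig2 : ∀ i, Integrable (fun y => ∫ x, f' i (Fin.cons x y) ^ 2 ∂(gaussianReal 0 1))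
        (gaussianPi n) := fun i =>
      bd (avc (u := fun z => f' i z ^ 2) ((hf' i).pow 2) (sqb (hM' i)))
        (avb (u := fun z => f' i z ^ 2) (sqb (hM' i)))
    have id2 : Integrable (fun y => d y ^ 2) (gaussianPi n) := bd (hdc.pow 2) (sqb hdb)
    have h2 := integral_mono (if2.sub iF2) ((ig2 0).sub (id2.const_mul (1 / 2))) h1
    simp only [Pi.sub_apply] at h2
    rw [integral_sub if2 iF2, integral_sub (ig2 0) (id2.const_mul _), integral_const_mul] at h2
    have hd1 := sq_integral_le_integral_sq (bd hdc hdb) id2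
    have e0 : ∫ z, z 0 * f' 0 z ∂(gaussianPi (n + 1)) = ∫ y, d y ∂(gaussianPi n) := by
      rw [integral_gaussianPi_succ (mb 0 (hf' 0) (hM' 0))]
      simp [hdd]
    have es : ∀ i : Fin n, ∫ z, z i.succ * f' i.succ z ∂(gaussianPi (n + 1)) =
        ∫ y, y i * F' i y ∂(gaussianPi n) := by
      intro i
      rw [integral_gaussianPi_succ (mb i.succ (hf' i.succ) (hM' i.succ))]
      simp [hF', integral_const_mul]
    have eg : ∀ i, ∫ z, f' i z ^ 2 ∂(gaussianPi (n + 1)) =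
        ∫ y, ∫ x, f' i (Fin.cons x y) ^ 2 ∂(gaussianReal 0 1) ∂(gaussianPi n) := fun i =>
      integral_gaussianPi_succ (bd (u := fun z => f' i z ^ 2) ((hf' i).pow 2) (sqb (hM' i)))
    have hJ : ∀ i : Fin n, ∫ y, F' i y ^ 2 ∂(gaussianPi n) ≤
        ∫ z, f' i.succ z ^ 2 ∂(gaussianPi (n + 1)) := by
      intro i
      rw [eg]
      refine integral_mono (bd ((avc (hf' i.succ) (hM' i.succ)).pow 2) (sqb (avb (hM' i.succ))))
        (ig2 i.succ) fun y => ?_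
      have := hf' i.succ
      exact sq_integral_le_integral_sq (bd1 (by fun_prop) fun x => hM' _ _)
        (bd1 (u := fun x => f' i.succ (Fin.cons x y) ^ 2) (by fun_prop)
          (sqb (u := fun x => f' i.succ (Fin.cons x y)) fun x => hM' _ _))
    have hsum : ∑ i, (∫ y, F' i y ^ 2 ∂(gaussianPi n)
          - 1 / 2 * (∫ y, y i * F' i y ∂(gaussianPi n)) ^ 2) ≤
        ∑ i : Fin n, (∫ z, f' i.succ z ^ 2 ∂(gaussianPi (n + 1))
          - 1 / 2 * (∫ z, z i.succ * f' i.succ z ∂(gaussianPi (n + 1))) ^ 2) :=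
      Finset.sum_le_sum fun i _ => by
        rw [es i]; linarith [hJ i]
    rw [Fin.sum_univ_succ, integral_gaussianPi_succ
        (bd (u := fun z => f z ^ 2) (hf.pow 2) (sqb hM)), integral_gaussianPi_succ (bd hf hM),
      e0, eg 0]
    change _ - (∫ y, F y ∂(gaussianPi n)) ^ 2 ≤ _
    linarith

/-! ### Generalized Cauchy distributions as Gaussian mixtures -/

theorem lintegral_pi_fin_succ (μ : Measure ℝ) [SigmaFinite μ] {n : ℕ}
    {φ : (Fin (n + 1) → ℝ) → ENNReal} (hφ : Measurable φ) :
    ∫⁻ z, φ z ∂(Measure.pi fun _ => μ) =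
      ∫⁻ y : Fin n → ℝ, ∫⁻ x, φ (Fin.cons x y) ∂μ ∂(Measure.pi fun _ => μ) := by
  have h := (measurePreserving_piFinSuccAbove (fun _ : Fin (n + 1) => μ) 0).symm
  rw [← h.lintegral_comp hφ, lintegral_prod_symm _ (by
    exact (hφ.comp h.measurable).aemeasurable)]
  refine lintegral_congr fun y => lintegral_congr fun x => ?_
  exact congrArg φ (Fin.insertNth_zero' x y)

theorem measurable_finCons (n : ℕ) :
    Measurable fun p : ℝ × (Fin n → ℝ) => (Fin.cons p.1 p.2 : Fin (n + 1) → ℝ) :=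
  (by fun_prop : Continuous fun p : ℝ × (Fin n → ℝ) =>
    (Fin.cons p.1 p.2 : Fin (n + 1) → ℝ)).measurable

theorem lintegral_gaussianPi (n : ℕ) : ∀ {ψ : (Fin n → ℝ) → ENNReal}, Measurable ψ →
    ∫⁻ z, ψ z ∂(gaussianPi n) = ∫⁻ z, ψ z * ∏ i, gaussianPDF 0 1 (z i) := by
  induction n with
  | zero =>
    intro ψ _
    simp [gaussianPi, volume_pi, Measure.pi_of_empty (x := default)]
  | succ n ih =>
    intro ψ hψ
    have hm := measurable_gaussianPDF 0 1
    rw [lintegral_pi_fin_succ _ hψ, volume_pi, lintegral_pi_fin_succ _ (by fun_prop)]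
    rw [ih (Measurable.lintegral_prod_left' (f := fun p : ℝ × (Fin n → ℝ) =>
      ψ (Fin.cons p.1 p.2)) (hψ.comp (measurable_finCons n))), volume_pi]
    refine lintegral_congr fun y => ?_
    have hψy : Measurable fun x : ℝ => ψ (Fin.cons x y) :=
      hψ.comp ((measurable_finCons n).comp (by fun_prop : Measurable fun x : ℝ => (x, y)))
    rw [gaussianReal_of_var_ne_zero _ one_ne_zero, lintegral_withDensity_eq_lintegral_mul _ hm hψy,
      ← lintegral_mul_const _ (hm.mul hψy)]
    refine lintegral_congr fun x => ?_
    simp only [Pi.mul_apply, Fin.prod_univ_succ, Fin.cons_zero, Fin.cons_succ]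
    ring

theorem prod_gaussianPDF (n : ℕ) (x : EuclideanSpace ℝ (Fin n)) :
    ∏ i, gaussianPDF 0 1 (x i) =
      ENNReal.ofReal ((√(2 * Real.pi))⁻¹ ^ n * Real.exp (-(‖x‖ ^ 2 / 2))) := by
  simp only [gaussianPDF]
  rw [← ENNReal.ofReal_prod_of_nonneg fun i _ => gaussianPDFReal_nonneg 0 1 _]
  congr 1
  simp only [gaussianPDFReal, Finset.prod_mul_distrib, Finset.prod_const, Finset.card_univ,
    Fintype.card_fin, ← Real.exp_sum, EuclideanSpace.real_norm_sq_eq]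
  simp [Finset.sum_div, neg_div]

/-- The law of `s^{-1/2} Z` has density `(s / 2π)^{n/2} exp(-s |x|² / 2)`. -/
theorem lintegral_gaussianPi_smul_toLp {n : ℕ} {ψ : EuclideanSpace ℝ (Fin n) → ENNReal}
    (hψ : Measurable ψ) {s : ℝ} (hs : 0 < s) :
    ∫⁻ z, ψ ((√s)⁻¹ • WithLp.toLp 2 z) ∂(gaussianPi n) =
      ∫⁻ x, ψ x * ENNReal.ofReal ((√(2 * Real.pi))⁻¹ ^ n * s ^ ((n : ℝ) / 2) *
        Real.exp (-(s * ‖x‖ ^ 2 / 2))) := by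
  set r := (√s)⁻¹ with hr
  have hr0 : 0 < r := inv_pos.2 (Real.sqrt_pos.2 hs)
  have hT : Measurable fun z : Fin n → ℝ => (WithLp.toLp 2 z : EuclideanSpace ℝ (Fin n)) :=
    (PiLp.volume_preserving_toLp (Fin n)).measurable
  have hψr : Measurable fun x => ψ (r • x) := hψ.comp (measurable_const_smul r)
  rw [lintegral_gaussianPi n (ψ := fun z => ψ (r • WithLp.toLp 2 z)) (hψr.comp hT)]
  set G : EuclideanSpace ℝ (Fin n) → ENNReal := fun x => ψ x *
    ENNReal.ofReal ((√(2 * Real.pi))⁻¹ ^ n * Real.exp (-(s * ‖x‖ ^ 2 / 2))) with hG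
  have hGm : Measurable G := hψ.mul (by fun_prop)
  have e1 : ∀ z : Fin n → ℝ, ψ (r • WithLp.toLp 2 z) * ∏ i, gaussianPDF 0 1 (z i)
      = G (r • WithLp.toLp 2 z) := by
    intro z
    have := prod_gaussianPDF n (WithLp.toLp 2 z)
    simp only at this
    rw [this]
    simp only [hG]
    congr 5
    rw [norm_smul, Real.norm_of_nonneg hr0.le, mul_pow, hr, inv_pow, Real.sq_sqrt hs.le]
    field_simp
  simp_rw [e1]
  rw [(PiLp.volume_preserving_toLp (Fin n)).lintegral_comp
      (f := fun x : EuclideanSpace ℝ (Fin n) => G (r • x)) (hGm.comp (measurable_const_smul r)),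
    ← lintegral_map hGm (measurable_const_smul r), Measure.map_addHaar_smul _ hr0.ne',
    lintegral_smul_measure, smul_eq_mul, ← lintegral_const_mul _ hGm]
  refine lintegral_congr fun x => ?_
  simp only [hG]
  rw [mul_left_comm, ← ENNReal.ofReal_mul (abs_nonneg _)]
  congr 2
  have : |(r ^ Module.finrank ℝ (EuclideanSpace ℝ (Fin n)))⁻¹| = s ^ ((n : ℝ) / 2) := by
    rw [finrank_euclideanSpace_fin, abs_of_pos (by positivity), hr, inv_pow, inv_inv,
      Real.sqrt_eq_rpow, ← Real.rpow_natCast, ← Real.rpow_mul hs.le]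
    congr 1; ring
  rw [this]; ring

theorem lintegral_rpow_mul_exp_neg_mul {k r : ℝ} (hk : 0 < k) (hr : 0 < r) :
    ∫⁻ t in Set.Ioi (0 : ℝ), ENNReal.ofReal (t ^ (k - 1) * Real.exp (-(r * t))) =
      ENNReal.ofReal ((1 / r) ^ k * Real.Gamma k) := by
  have hpos : 0 < (1 / r) ^ k * Real.Gamma k :=
    mul_pos (by positivity) (Real.Gamma_pos_of_pos hk)
  rw [← Real.integral_rpow_mul_exp_neg_mul_Ioi hk hr] at hpos ⊢
  rw [ofReal_integral_eq_lintegral_ofReal]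
  · by_contra h
    rw [integral_undef h] at hpos
    exact lt_irrefl _ hpos
  · filter_upwards [ae_restrict_mem measurableSet_Ioi] with t ht
    have := Real.rpow_pos_of_pos ht (k - 1)
    positivity

theorem lintegral_gammaMeasure {a r : ℝ} {φ : ℝ → ENNReal} (hφ : Measurable φ) :
    ∫⁻ s, φ s ∂(gammaMeasure a r) = ∫⁻ s in Set.Ioi 0, gammaPDF a r s * φ s := by
  rw [gammaMeasure_eq_restrict_withDensity,
    lintegral_withDensity_eq_lintegral_mul _ (measurable_gammaPDF a r) hφ]
  rfl

/-- The Gamma mixture of the Gaussian laws of variance `1 / s`, weighted by `s^{-j}`: integrating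
out `s` against `s^{β - j - 1} exp(-s (1 + |x|²) / 2)` leaves a power of `1 + |x|²`. The exponent
`j = 0` gives `ν_β`, and `j = 1` gives the weight of the Dirichlet form. -/
theorem lintegral_gamma_gaussianPi {n : ℕ} {β j : ℝ} (hβ : (n : ℝ) / 2 < β) (hj : 0 < β - j)
    {ψ : EuclideanSpace ℝ (Fin n) → ENNReal} (hψ : Measurable ψ) :
    ∫⁻ s, ENNReal.ofReal (s ^ (-j)) * ∫⁻ z, ψ ((√s)⁻¹ • WithLp.toLp 2 z) ∂(gaussianPi n)
        ∂(gammaMeasure (β - n / 2) (1 / 2)) =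
      ENNReal.ofReal ((√(2 * Real.pi))⁻¹ ^ n * ((1 / 2) ^ (β - n / 2) / Real.Gamma (β - n / 2)) *
        (2 ^ (β - j) * Real.Gamma (β - j))) *
      ∫⁻ x, ψ x * ENNReal.ofReal ((1 + ‖x‖ ^ 2) ^ (-(β - j))) := by
  have ha : 0 < β - n / 2 := sub_pos.2 hβ
  set c := (√(2 * Real.pi))⁻¹ ^ n * ((1 / 2) ^ (β - n / 2) / Real.Gamma (β - n / 2)) with hc
  have hc0 : 0 ≤ c := by
    have := Real.Gamma_pos_of_pos ha
    positivity
  have hT : Measurable fun z : Fin n → ℝ => (WithLp.toLp 2 z : EuclideanSpace ℝ (Fin n)) :=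
    (PiLp.volume_preserving_toLp (Fin n)).measurable
  have hmeas : Measurable fun s : ℝ =>
      ∫⁻ z, ψ ((√s)⁻¹ • WithLp.toLp 2 z) ∂(gaussianPi n) := by
    refine Measurable.lintegral_prod_right' (f := fun p : ℝ × (Fin n → ℝ) =>
      ψ ((√p.1)⁻¹ • WithLp.toLp 2 p.2)) (hψ.comp ?_)
    exact (Real.continuous_sqrt.measurable.comp measurable_fst).inv.smul (hT.comp measurable_snd)
  have hmj : Measurable fun s : ℝ => ENNReal.ofReal (s ^ (-j)) := by fun_prop
  rw [lintegral_gammaMeasure (by fun_prop)]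
  have e1 : ∀ s ∈ Set.Ioi (0 : ℝ), gammaPDF (β - n / 2) (1 / 2) s * (ENNReal.ofReal (s ^ (-j)) *
      ∫⁻ z, ψ ((√s)⁻¹ • WithLp.toLp 2 z) ∂(gaussianPi n)) =
      ∫⁻ x, ψ x * (ENNReal.ofReal c * ENNReal.ofReal
        (s ^ (β - j - 1) * Real.exp (-((1 + ‖x‖ ^ 2) / 2 * s)))) := by
    intro s hs
    have hs' : 0 < s := hs
    have hG := Real.Gamma_pos_of_pos ha
    rw [lintegral_gaussianPi_smul_toLp hψ hs, gammaPDF_of_nonneg hs'.le, ← mul_assoc,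
      ← ENNReal.ofReal_mul (by positivity), ← lintegral_const_mul _ (by fun_prop)]
    refine lintegral_congr fun x => ?_
    rw [mul_left_comm, ← ENNReal.ofReal_mul (by positivity), ← ENNReal.ofReal_mul hc0]
    congr 2
    have r1 : s ^ (β - j - 1) = s ^ (β - n / 2 - 1) * s ^ (-j) * s ^ ((n : ℝ) / 2) := by
      rw [← Real.rpow_add hs', ← Real.rpow_add hs']; congr 1; ring
    have r2 : Real.exp (-((1 + ‖x‖ ^ 2) / 2 * s)) =
        Real.exp (-(1 / 2 * s)) * Real.exp (-(s * ‖x‖ ^ 2 / 2)) := by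
      rw [← Real.exp_add]; congr 1; ring
    rw [r1, r2, hc]; ring
  rw [setLIntegral_congr_fun measurableSet_Ioi e1, lintegral_lintegral_swap]
  · rw [← lintegral_const_mul _ (by fun_prop)]
    refine lintegral_congr fun x => ?_
    have hx : 0 < (1 + ‖x‖ ^ 2) / 2 := by positivity
    rw [lintegral_const_mul _ (by fun_prop), lintegral_const_mul _ (by fun_prop),
      lintegral_rpow_mul_exp_neg_mul hj hx, ← ENNReal.ofReal_mul hc0,
      mul_left_comm (ENNReal.ofReal _), ← ENNReal.ofReal_mul (mul_nonneg hc0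
        (mul_nonneg (by positivity) (Real.Gamma_pos_of_pos hj).le))]
    congr 2
    rw [one_div_div, Real.div_rpow (by norm_num) (by positivity), Real.rpow_neg (by positivity)]
    ring
  · have : Measurable fun p : ℝ × EuclideanSpace ℝ (Fin n) => ψ p.2 := hψ.comp measurable_snd
    exact (this.mul (by fun_prop)).aemeasurable

theorem lintegral_genCauchy {n : ℕ} {β : ℝ} {ψ : EuclideanSpace ℝ (Fin n) → ENNReal}
    (hψ : Measurable ψ) :
    ∫⁻ x, ψ x ∂(genCauchy n β) =
      ENNReal.ofReal (1 / cauchyZ n β) * ∫⁻ x, ψ x * ENNReal.ofReal ((1 + ‖x‖ ^ 2) ^ (-β)) := by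
  have hZ : 0 ≤ 1 / cauchyZ n β :=
    one_div_nonneg.2 (integral_nonneg fun x => by positivity)
  rw [genCauchy, lintegral_withDensity_eq_lintegral_mul _ (by fun_prop) hψ,
    ← lintegral_const_mul _ (by fun_prop)]
  refine lintegral_congr fun x => ?_
  rw [Pi.mul_apply, ENNReal.ofReal_mul hZ]
  ring

/-- The explicit constant of the mixture equals `1 / Z`, because both sides normalize the same
density to a probability measure; no separate evaluation of `Z` is needed. -/
theorem ofReal_mixing_const_eq {n : ℕ} {β : ℝ} (hβ : (n : ℝ) / 2 < β) :
    ENNReal.ofReal ((√(2 * Real.pi))⁻¹ ^ n * ((1 / 2) ^ (β - n / 2) / Real.Gamma (β - n / 2)) *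
      (2 ^ β * Real.Gamma β)) = ENNReal.ofReal (1 / cauchyZ n β) := by
  have hβ0 : 0 < β := lt_of_le_of_lt (by positivity) hβ
  have ha : 0 < β - n / 2 := sub_pos.2 hβ
  have := isProbabilityMeasure_genCauchy n β hβ
  have := isProbabilityMeasure_gammaMeasure ha (by norm_num : (0 : ℝ) < 1 / 2)
  have h1 := lintegral_genCauchy (n := n) (β := β) (ψ := fun _ => 1) measurable_const
  have h2 := lintegral_gamma_gaussianPi (n := n) (β := β) (j := 0) hβ (by simpa using hβ0)
    (ψ := fun _ => 1) measurable_const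
  simp only [lintegral_const, measure_univ, one_mul, neg_zero, Real.rpow_zero, ENNReal.ofReal_one,
    sub_zero] at h1 h2
  rw [ENNReal.eq_inv_of_mul_eq_one_left h1.symm, ENNReal.eq_inv_of_mul_eq_one_left h2.symm]

theorem lintegral_genCauchy_eq_mixture {n : ℕ} {β : ℝ} (hβ : (n : ℝ) / 2 < β)
    {ψ : EuclideanSpace ℝ (Fin n) → ENNReal} (hψ : Measurable ψ) :
    ∫⁻ x, ψ x ∂(genCauchy n β) =
      ∫⁻ s, ∫⁻ z, ψ ((√s)⁻¹ • WithLp.toLp 2 z) ∂(gaussianPi n)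
        ∂(gammaMeasure (β - n / 2) (1 / 2)) := by
  have hβ0 : 0 < β := lt_of_le_of_lt (by positivity) hβ
  have h := lintegral_gamma_gaussianPi (j := 0) hβ (by simpa using hβ0) hψ
  simp only [neg_zero, Real.rpow_zero, ENNReal.ofReal_one, one_mul, sub_zero] at h
  rw [h, ofReal_mixing_const_eq hβ, lintegral_genCauchy hψ]

/-- The identity `E[1 / G | X = x] = (1 + |x|²) / (2 (β - 1))`, integrated against `ψ`. -/
theorem lintegral_mixture_div_eq {n : ℕ} {β : ℝ} (hβ : (n : ℝ) / 2 < β) (hβ1 : 1 < β)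
    {ψ : EuclideanSpace ℝ (Fin n) → ENNReal} (hψ : Measurable ψ) :
    ∫⁻ s, ENNReal.ofReal (s⁻¹) * ∫⁻ z, ψ ((√s)⁻¹ • WithLp.toLp 2 z) ∂(gaussianPi n)
        ∂(gammaMeasure (β - n / 2) (1 / 2)) =
      ENNReal.ofReal (1 / (2 * (β - 1))) *
        ∫⁻ x, ψ x * ENNReal.ofReal (1 + ‖x‖ ^ 2) ∂(genCauchy n β) := by
  have hb : 0 < β - 1 := sub_pos.2 hβ1
  have h := lintegral_gamma_gaussianPi (j := 1) hβ hb hψ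
  simp only [Real.rpow_neg_one] at h
  rw [h, lintegral_genCauchy (ψ := fun x => ψ x * ENNReal.ofReal (1 + ‖x‖ ^ 2)) (by fun_prop),
    ← ofReal_mixing_const_eq hβ,
    ← mul_assoc (ENNReal.ofReal _) (ENNReal.ofReal _),
    ← ENNReal.ofReal_mul (by positivity)]
  congr 1
  · congr 1
    have e1 : Real.Gamma β = (β - 1) * Real.Gamma (β - 1) := by
      have := Real.Gamma_add_one hb.ne'
      rwa [sub_add_cancel] at this
    have e2 : (2 : ℝ) ^ β = 2 ^ (β - 1) * 2 := by
      rw [← Real.rpow_add_one (by norm_num)]; congr 1; ring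
    rw [e1, e2]
    field_simp
  · refine lintegral_congr fun x => ?_
    have hx : 0 < 1 + ‖x‖ ^ 2 := by positivity
    rw [mul_assoc, ← ENNReal.ofReal_mul hx.le]
    congr 2
    rw [mul_comm, ← Real.rpow_add_one hx.ne']
    congr 1; ring

/-! ### The inequality for compactly supported functions -/

theorem measurable_mixing_map (n : ℕ) : Measurable fun p : ℝ × (Fin n → ℝ) =>
    ((√p.1)⁻¹ • WithLp.toLp 2 p.2 : EuclideanSpace ℝ (Fin n)) :=
  (Real.continuous_sqrt.measurable.comp measurable_fst).inv.smul
    ((PiLp.volume_preserving_toLp (Fin n)).measurable.comp measurable_snd)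

theorem genCauchy_eq_map {n : ℕ} {β : ℝ} (hβ : (n : ℝ) / 2 < β) :
    genCauchy n β = Measure.map (fun p : ℝ × (Fin n → ℝ) =>
      ((√p.1)⁻¹ • WithLp.toLp 2 p.2 : EuclideanSpace ℝ (Fin n)))
      ((gammaMeasure (β - n / 2) (1 / 2)).prod (gaussianPi n)) := by
  have := isProbabilityMeasure_gammaMeasure (sub_pos.2 hβ) (by norm_num : (0 : ℝ) < 1 / 2)
  refine Measure.ext_of_lintegral _ fun ψ hψ => ?_
  rw [lintegral_map hψ (measurable_mixing_map n),
    lintegral_prod _ (by exact (hψ.comp (measurable_mixing_map n)).aemeasurable),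
    lintegral_genCauchy_eq_mixture hβ hψ]

theorem integral_genCauchy_eq_mixture {n : ℕ} {β : ℝ} (hβ : (n : ℝ) / 2 < β)
    {u : EuclideanSpace ℝ (Fin n) → ℝ} {M : ℝ} (hu : Continuous u) (hM : ∀ x, |u x| ≤ M) :
    Integrable (fun s : ℝ => ∫ z, u ((√s)⁻¹ • WithLp.toLp 2 z) ∂(gaussianPi n))
      (gammaMeasure (β - n / 2) (1 / 2)) ∧
    ∫ x, u x ∂(genCauchy n β) =
      ∫ s, ∫ z, u ((√s)⁻¹ • WithLp.toLp 2 z) ∂(gaussianPi n)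
        ∂(gammaMeasure (β - n / 2) (1 / 2)) := by
  have := isProbabilityMeasure_gammaMeasure (sub_pos.2 hβ) (by norm_num : (0 : ℝ) < 1 / 2)
  have hi : Integrable (fun p : ℝ × (Fin n → ℝ) => u ((√p.1)⁻¹ • WithLp.toLp 2 p.2))
      ((gammaMeasure (β - n / 2) (1 / 2)).prod (gaussianPi n)) :=
    Integrable.of_bound (C := M) (hu.measurable.comp (measurable_mixing_map n)).aestronglyMeasurable
      (Eventually.of_forall fun p => hM _)
  refine ⟨hi.integral_prod_left, ?_⟩
  rw [genCauchy_eq_map hβ, integral_map (measurable_mixing_map n).aemeasurable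
    hu.aestronglyMeasurable, integral_prod _ hi]

theorem norm_fderiv_sq_eq_sum {n : ℕ} (L : EuclideanSpace ℝ (Fin n) →L[ℝ] ℝ) :
    ‖L‖ ^ 2 = ∑ i, L (EuclideanSpace.single i 1) ^ 2 := by
  obtain ⟨v, rfl⟩ := (InnerProductSpace.toDual ℝ (EuclideanSpace ℝ (Fin n))).surjective L
  simp [EuclideanSpace.real_norm_sq_eq, EuclideanSpace.inner_single_right]

/-- The conditional inequality given `G = s`. The number `S` is the sum over the coordinates of
`(E[x_i ∂_i g(x)])²`; it is at least `D(s)² / n` by Cauchy–Schwarz. -/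
theorem variance_gaussian_scaled_le {n : ℕ} {g : EuclideanSpace ℝ (Fin n) → ℝ}
    (hg : ContDiff ℝ 1 g) (hgc : HasCompactSupport g) {s : ℝ} (hs : 0 < s) :
    ∃ S : ℝ, 0 ≤ S ∧ (∫ z, fderiv ℝ g ((√s)⁻¹ • WithLp.toLp 2 z) ((√s)⁻¹ • WithLp.toLp 2 z)
        ∂(gaussianPi n)) ^ 2 ≤ n * S ∧
      ∫ z, g ((√s)⁻¹ • WithLp.toLp 2 z) ^ 2 ∂(gaussianPi n)
        - (∫ z, g ((√s)⁻¹ • WithLp.toLp 2 z) ∂(gaussianPi n)) ^ 2 ≤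
      s⁻¹ * ∫ z, ‖fderiv ℝ g ((√s)⁻¹ • WithLp.toLp 2 z)‖ ^ 2 ∂(gaussianPi n) - 1 / 2 * S := by
  set r := (√s)⁻¹ with hr
  have hr2 : r ^ 2 = s⁻¹ := by rw [hr, inv_pow, Real.sq_sqrt hs.le]
  have hfd : Continuous (fderiv ℝ g) := hg.continuous_fderiv one_ne_zero
  obtain ⟨M, hM⟩ := hgc.exists_bound_of_continuous hg.continuous
  obtain ⟨B, hB⟩ := (hgc.fderiv ℝ).exists_bound_of_continuous hfd
  have hT : Continuous fun z : Fin n → ℝ => (r • WithLp.toLp 2 z : EuclideanSpace ℝ (Fin n)) := by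
    fun_prop
  set f' : Fin n → (Fin n → ℝ) → ℝ := fun i z =>
    r * fderiv ℝ g (r • WithLp.toLp 2 z) (EuclideanSpace.single i 1) with hf'
  have hf'c : ∀ i, Continuous (f' i) := fun i => by
    simp only [hf']
    exact continuous_const.mul ((hfd.comp hT).clm_apply continuous_const)
  have hf'b : ∀ i z, |f' i z| ≤ |r| * B := by
    intro i z
    simp only [hf', abs_mul]
    refine mul_le_mul_of_nonneg_left ?_ (abs_nonneg _)
    have := (fderiv ℝ g (r • WithLp.toLp 2 z)).le_opNorm (EuclideanSpace.single i (1 : ℝ))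
    simp only [Real.norm_eq_abs, PiLp.norm_single, norm_one, mul_one] at this
    exact this.trans (hB _)
  have hd : ∀ i z, HasDerivAt (fun t => g (r • WithLp.toLp 2 (Function.update z i t)))
      (f' i z) (z i) := by
    intro i z
    have h1 : HasDerivAt (fun t : ℝ =>
        (r • WithLp.toLp 2 (Function.update z i t) : EuclideanSpace ℝ (Fin n)))
        (r • EuclideanSpace.single i 1) (z i) := by
      have : (fun t : ℝ => (r • WithLp.toLp 2 (Function.update z i t) :
          EuclideanSpace ℝ (Fin n))) = fun t => r • WithLp.toLp 2 z +
            (t - z i) • (r • EuclideanSpace.single i (1 : ℝ)) := by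
        funext t
        ext j
        by_cases hj : j = i
        · subst hj; simp; ring
        · simp [hj]
      rw [this]
      simpa using (((hasDerivAt_id' (z i)).sub_const (z i)).smul_const
        (r • EuclideanSpace.single i (1 : ℝ) : EuclideanSpace ℝ (Fin n))).const_add
          (r • WithLp.toLp 2 z : EuclideanSpace ℝ (Fin n))
    have h2 : HasFDerivAt g (fderiv ℝ g (r • WithLp.toLp 2 z))
        (r • WithLp.toLp 2 (Function.update z i (z i))) := by
      rw [Function.update_eq_self]
      exact (hg.differentiable one_ne_zero _).hasFDerivAt
    simpa [hf', Function.comp_def] using h2.comp_hasDerivAt _ h1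
  have main := variance_add_half_sum_sq_le_gaussianPi n
    (f := fun z => g (r • WithLp.toLp 2 z)) (f' := f') (hg.continuous.comp hT) hf'c
    (fun z => hM _) hf'b hd
  refine ⟨∑ i, (∫ z, z i * f' i z ∂(gaussianPi n)) ^ 2,
    Finset.sum_nonneg fun i _ => sq_nonneg _, ?_, ?_⟩
  · have e : ∫ z, fderiv ℝ g (r • WithLp.toLp 2 z) (r • WithLp.toLp 2 z) ∂(gaussianPi n) =
        ∑ i, ∫ z, z i * f' i z ∂(gaussianPi n) := by
      rw [← integral_finsetSum]
      · refine integral_congr_ae (Eventually.of_forall fun z => ?_)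
        have hz : (WithLp.toLp 2 z : EuclideanSpace ℝ (Fin n)) =
            ∑ i, z i • EuclideanSpace.single i (1 : ℝ) := by
          ext j
          simp [Finset.sum_apply, Pi.single_apply]
        simp only [hf']
        conv_lhs => rw [map_smul]; arg 2; arg 2; rw [hz]
        simp only [map_sum, map_smul, smul_eq_mul, Finset.mul_sum]
        exact Finset.sum_congr rfl fun i _ => by ring
      · intro i _
        exact (integrable_eval_gaussianPi i).mul_bdd (c := |r| * B) (hf'c i).aestronglyMeasurable
          (Eventually.of_forall (hf'b i))
    rw [e]
    simpa using sq_sum_le_card_mul_sum_sq (s := Finset.univ)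
      (f := fun i : Fin n => ∫ z, z i * f' i z ∂(gaussianPi n))
  · refine main.trans (le_of_eq ?_)
    rw [Finset.sum_sub_distrib, ← Finset.mul_sum, ← integral_finsetSum, ← integral_const_mul]
    · congr 1
      refine integral_congr_ae (Eventually.of_forall fun z => ?_)
      simp only [hf', norm_fderiv_sq_eq_sum, mul_pow, hr2, Finset.mul_sum]
    · intro i _
      refine Integrable.of_bound (C := (|r| * B) ^ 2) ((hf'c i).pow 2).aestronglyMeasurable
        (Eventually.of_forall fun z => ?_)
      rw [norm_pow]
      exact pow_le_pow_left₀ (norm_nonneg _) (hf'b i z) 2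

/-- The radial derivative of the Gaussian average: `h'(s) = -D(s) / (2 s)`. -/
theorem hasDerivAt_gaussian_average {n : ℕ} {g : EuclideanSpace ℝ (Fin n) → ℝ}
    (hg : ContDiff ℝ 1 g) (hgc : HasCompactSupport g) {s : ℝ} (hs : 0 < s) :
    HasDerivAt (fun s : ℝ => ∫ z, g ((√s)⁻¹ • WithLp.toLp 2 z) ∂(gaussianPi n))
      (-(1 / (2 * s)) * ∫ z, fderiv ℝ g ((√s)⁻¹ • WithLp.toLp 2 z) ((√s)⁻¹ • WithLp.toLp 2 z)
        ∂(gaussianPi n)) s := by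
  have hfd : Continuous (fderiv ℝ g) := hg.continuous_fderiv one_ne_zero
  have hec : Continuous fun x => fderiv ℝ g x x := hfd.clm_apply continuous_id
  have hes : HasCompactSupport fun x => fderiv ℝ g x x :=
    (hgc.fderiv ℝ).mono fun x hx h => hx (by simp [h])
  obtain ⟨M, hM⟩ := hgc.exists_bound_of_continuous hg.continuous
  obtain ⟨B, hB⟩ := hes.exists_bound_of_continuous hec
  have hT : ∀ s : ℝ, Continuous fun z : Fin n → ℝ =>
    ((√s)⁻¹ • WithLp.toLp 2 z : EuclideanSpace ℝ (Fin n)) := fun s => by fun_prop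
  rw [← integral_const_mul]
  have hB0 : 0 ≤ B := (norm_nonneg _).trans (hB 0)
  refine (hasDerivAt_integral_of_dominated_loc_of_deriv_le (bound := fun _ => 1 / s * B)
    (F := fun s z => g ((√s)⁻¹ • WithLp.toLp 2 z))
    (F' := fun s z => -(1 / (2 * s)) * fderiv ℝ g ((√s)⁻¹ • WithLp.toLp 2 z)
      ((√s)⁻¹ • WithLp.toLp 2 z))
    (s := Set.Ioi (s / 2)) (Ioi_mem_nhds (by linarith))
    (Eventually.of_forall fun t => (hg.continuous.comp (hT t)).aestronglyMeasurable)
    (Integrable.of_bound (C := M) (hg.continuous.comp (hT s)).aestronglyMeasurable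
      (Eventually.of_forall fun z => hM _))
    (continuous_const.mul (hec.comp (hT s))).aestronglyMeasurable
    (Eventually.of_forall fun z t ht => ?_) (integrable_const _)
    (Eventually.of_forall fun z t ht => ?_)).2
  · have ht' : s / 2 < t := ht
    have ht0 : 0 < t := by linarith
    rw [norm_mul, norm_neg, Real.norm_of_nonneg (by positivity)]
    refine mul_le_mul ?_ (hB _) (norm_nonneg _) (by positivity)
    exact one_div_le_one_div_of_le hs (by linarith)
  · have ht' : s / 2 < t := ht
    have ht0 : 0 < t := by linarith
    have hsq : 0 < √t := Real.sqrt_pos.2 ht0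
    have h1 : HasDerivAt (fun t : ℝ => (√t)⁻¹) (-(1 / (2 * t)) * (√t)⁻¹) t := by
      refine ((Real.hasDerivAt_sqrt ht0.ne').fun_inv hsq.ne').congr_deriv ?_
      rw [Real.sq_sqrt ht0.le]
      field_simp
    have h2 := h1.smul_const (WithLp.toLp 2 z : EuclideanSpace ℝ (Fin n))
    have h3 := (hg.differentiable one_ne_zero
      ((√t)⁻¹ • WithLp.toLp 2 z)).hasFDerivAt.comp_hasDerivAt t h2
    simpa [mul_smul, mul_assoc, Function.comp_def] using h3

theorem variance_genCauchy_le_of_hasCompactSupport {n : ℕ} {β c C : ℝ} (hβ : (n : ℝ) / 2 < β)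
    (hβ1 : 1 < β) (hc : 0 < c) (hcβ : c < β - n / 2) (hc1 : c ≤ 1) (hC1 : 1 ≤ C)
    (hCn : n / (2 * (c * (β - n / 2 - c))) ≤ C) {g : EuclideanSpace ℝ (Fin n) → ℝ}
    (hg : ContDiff ℝ 1 g) (hgc : HasCompactSupport g) :
    ENNReal.ofReal (∫ x, g x ^ 2 ∂(genCauchy n β) - (∫ x, g x ∂(genCauchy n β)) ^ 2) ≤
      ENNReal.ofReal (C / (2 * (β - 1))) *
        ∫⁻ x, ENNReal.ofReal (‖fderiv ℝ g x‖ ^ 2 * (1 + ‖x‖ ^ 2)) ∂(genCauchy n β) := by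
  have ha : 0 < β - n / 2 := sub_pos.2 hβ
  have h2 : (0 : ℝ) < 1 / 2 := by norm_num
  have hac : 0 < β - n / 2 - c := sub_pos.2 hcβ
  have hb : 0 < β - 1 := sub_pos.2 hβ1
  have hprob := isProbabilityMeasure_gammaMeasure ha h2
  set Γ := gammaMeasure (β - n / 2) (1 / 2) with hΓ
  have hfd : Continuous (fderiv ℝ g) := hg.continuous_fderiv one_ne_zero
  have hec : Continuous fun x => fderiv ℝ g x x := hfd.clm_apply continuous_id
  have hes : HasCompactSupport fun x => fderiv ℝ g x x :=
    (hgc.fderiv ℝ).mono fun x hx h => hx (by simp [h])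
  obtain ⟨M, hM⟩ := hgc.exists_bound_of_continuous hg.continuous
  obtain ⟨B, hB⟩ := hes.exists_bound_of_continuous hec
  obtain ⟨B₁, hB₁⟩ := (hgc.fderiv ℝ).exists_bound_of_continuous hfd
  have hM2 : ∀ x, |g x ^ 2| ≤ M ^ 2 := fun x => by
    rw [abs_pow]; exact pow_le_pow_left₀ (abs_nonneg _) (hM x) 2
  have hT : ∀ s : ℝ, Continuous fun z : Fin n → ℝ =>
    ((√s)⁻¹ • WithLp.toLp 2 z : EuclideanSpace ℝ (Fin n)) := fun s => by fun_prop
  set m : ℝ → ℝ := fun s => ∫ z, g ((√s)⁻¹ • WithLp.toLp 2 z) ^ 2 ∂(gaussianPi n) with hm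
  set h : ℝ → ℝ := fun s => ∫ z, g ((√s)⁻¹ • WithLp.toLp 2 z) ∂(gaussianPi n) with hh
  set D : ℝ → ℝ := fun s => ∫ z, fderiv ℝ g ((√s)⁻¹ • WithLp.toLp 2 z)
    ((√s)⁻¹ • WithLp.toLp 2 z) ∂(gaussianPi n) with hD
  set N : ℝ → ℝ := fun s => ∫ z, ‖fderiv ℝ g ((√s)⁻¹ • WithLp.toLp 2 z)‖ ^ 2 ∂(gaussianPi n)
    with hN
  have bnd : ∀ {u : EuclideanSpace ℝ (Fin n) → ℝ} {b : ℝ}, (∀ x, |u x| ≤ b) → ∀ s : ℝ,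
      |∫ z, u ((√s)⁻¹ • WithLp.toLp 2 z) ∂(gaussianPi n)| ≤ b := by
    intro u b hb s
    have := norm_integral_le_of_norm_le_const (μ := gaussianPi n) (C := b)
      (f := fun z => u ((√s)⁻¹ • WithLp.toLp 2 z)) (Eventually.of_forall fun z => hb _)
    simpa using this
  have hsqrtinv : ContinuousOn (fun s : ℝ => (√s)⁻¹) (Set.Ioi 0) :=
    Real.continuous_sqrt.continuousOn.inv₀ fun s hs => (Real.sqrt_pos.2 hs).ne'
  have hDc : ContinuousOn D (Set.Ioi 0) := by
    refine continuousOn_of_dominated (bound := fun _ => B)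
      (fun s _ => (hec.comp (hT s)).aestronglyMeasurable)
      (fun s _ => Eventually.of_forall fun z => hB _) (integrable_const _)
      (Eventually.of_forall fun z => ?_)
    exact hec.comp_continuousOn (hsqrtinv.smul continuousOn_const)
  have hhd : ∀ s, 0 < s → HasDerivAt h (-(1 / (2 * s)) * D s) s := fun s hs =>
    hasDerivAt_gaussian_average hg hgc hs
  have hhc : ContinuousOn h (Set.Ioi 0) := fun s hs =>
    (hhd s hs).continuousAt.continuousWithinAt
  have hsh : ∀ s : ℝ, 0 < s → s * (-(1 / (2 * s)) * D s) = -(D s / 2) := by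
    intro s hs; field_simp
  have hDb : ∀ s, |D s| ≤ B := bnd hB
  have hgam := variance_le_gammaMeasure (a := β - n / 2) hc hcβ hc1 (h := h)
    (h' := fun s => -(1 / (2 * s)) * D s) (M := M) (M' := B) hhd
    (ContinuousOn.mul (ContinuousOn.neg (continuousOn_const.div (by fun_prop)
      fun s hs => (by have : (0 : ℝ) < s := hs; positivity))) hDc)
    (fun s _ => bnd hM s)
    (fun s hs => by
      rw [hsh s hs, abs_neg, abs_div, abs_two]
      have := hDb s
      have := abs_nonneg (D s)
      linarith)
  have hgam' : ∫ s, (s * (-(1 / (2 * s)) * D s)) ^ 2 ∂Γ = 1 / 4 * ∫ s, D s ^ 2 ∂Γ := by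
    rw [← integral_const_mul]
    refine integral_congr_ae ?_
    filter_upwards [ae_pos_gammaMeasure (β - n / 2) (1 / 2)] with s hs
    rw [hsh s hs]; ring
  rw [← hΓ, hgam'] at hgam
  obtain ⟨im, em⟩ := integral_genCauchy_eq_mixture hβ (hg.continuous.pow 2) hM2
  obtain ⟨-, eh⟩ := integral_genCauchy_eq_mixture hβ hg.continuous hM
  simp only [Pi.pow_apply] at im em
  have ih2 : Integrable (fun s => h s ^ 2) Γ :=
    integrable_gammaMeasure_of_continuousOn ha h2 (M := M ^ 2) (hhc.pow 2) fun s _ => by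
      rw [abs_pow]; exact pow_le_pow_left₀ (abs_nonneg _) (bnd hM s) 2
  have iD2 : Integrable (fun s => D s ^ 2) Γ :=
    integrable_gammaMeasure_of_continuousOn ha h2 (M := B ^ 2) (hDc.pow 2) fun s _ => by
      rw [abs_pow]; exact pow_le_pow_left₀ (abs_nonneg _) (hDb s) 2
  set K : ℝ := 1 / (c * (β - n / 2 - c)) with hK
  have hK0 : 0 < K := by positivity
  have hVnn : ∀ s, 0 ≤ m s - h s ^ 2 := fun s => sub_nonneg.2 <|
    sq_integral_le_integral_sq
      (Integrable.of_bound (C := M) (hg.continuous.comp (hT s)).aestronglyMeasurable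
        (Eventually.of_forall fun z => hM _))
      (Integrable.of_bound (C := M ^ 2) ((hg.continuous.comp (hT s)).pow 2).aestronglyMeasurable
        (Eventually.of_forall fun z => hM2 _))
  -- The conditional variance `V` satisfies `S / 2 ≤ A - V`, so that
  -- `V + (K / 4) D² ≤ V + C (A - V) ≤ C A`, using `V ≥ 0` and `C ≥ 1`.
  have hpt : ∀ s, 0 < s → m s - h s ^ 2 + K / 4 * D s ^ 2 ≤ C * (s⁻¹ * N s) := by
    intro s hs
    obtain ⟨S, hS, hS1, hS2⟩ := variance_gaussian_scaled_le hg hgc hs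
    change D s ^ 2 ≤ n * S at hS1
    change m s - h s ^ 2 ≤ s⁻¹ * N s - 1 / 2 * S at hS2
    have hKn : K * n / 2 ≤ C := by
      refine le_trans (le_of_eq ?_) hCn
      rw [hK]; field_simp
    have hV := hVnn s
    have h1 : K / 4 * D s ^ 2 ≤ C * (1 / 2 * S) := by
      calc K / 4 * D s ^ 2 ≤ K / 4 * (n * S) := by gcongr
        _ = (K * n / 2) * (1 / 2 * S) := by ring
        _ ≤ C * (1 / 2 * S) := by gcongr
    nlinarith
  have iV : Integrable (fun s => m s - h s ^ 2) Γ := im.sub ih2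
  have iVD : Integrable (fun s => m s - h s ^ 2 + K / 4 * D s ^ 2) Γ := iV.add (iD2.const_mul _)
  have hreal : ∫ x, g x ^ 2 ∂(genCauchy n β) - (∫ x, g x ∂(genCauchy n β)) ^ 2 ≤
      ∫ s, (m s - h s ^ 2 + K / 4 * D s ^ 2) ∂Γ := by
    rw [em, eh, integral_add iV (iD2.const_mul _), integral_sub im ih2,
      integral_const_mul]
    change ∫ s, m s ∂Γ - (∫ s, h s ∂Γ) ^ 2 ≤ _
    linarith
  refine (ENNReal.ofReal_le_ofReal hreal).trans ?_
  rw [ofReal_integral_eq_lintegral_ofReal iVD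
    (Eventually.of_forall fun s => by
      have := hVnn s
      simp only [Pi.zero_apply]
      positivity)]
  -- The lower Lebesgue integral is used from here on, because `1 / s` need not be integrable for
  -- small shape parameters.
  calc ∫⁻ s, ENNReal.ofReal (m s - h s ^ 2 + K / 4 * D s ^ 2) ∂Γ
      ≤ ∫⁻ s, ENNReal.ofReal C * (ENNReal.ofReal s⁻¹ *
          ∫⁻ z, ENNReal.ofReal (‖fderiv ℝ g ((√s)⁻¹ • WithLp.toLp 2 z)‖ ^ 2)
            ∂(gaussianPi n)) ∂Γ := by
        refine lintegral_mono_ae ?_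
        filter_upwards [ae_pos_gammaMeasure (β - n / 2) (1 / 2)] with s hs
        refine (ENNReal.ofReal_le_ofReal (hpt s hs)).trans (le_of_eq ?_)
        rw [ENNReal.ofReal_mul (by linarith), ENNReal.ofReal_mul (inv_nonneg.2 hs.le), hN,
          ofReal_integral_eq_lintegral_ofReal]
        · refine Integrable.of_bound (C := B₁ ^ 2)
            ((hfd.comp (hT s)).norm.pow 2).aestronglyMeasurable
            (Eventually.of_forall fun z => ?_)
          rw [norm_pow, norm_norm]
          exact pow_le_pow_left₀ (norm_nonneg _) (hB₁ _) 2
        · exact Eventually.of_forall fun z => by positivity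
    _ = _ := by
        rw [lintegral_const_mul', lintegral_mixture_div_eq hβ hβ1
          (ψ := fun x => ENNReal.ofReal (‖fderiv ℝ g x‖ ^ 2))
          (hfd.norm.pow 2).measurable.ennreal_ofReal, ← mul_assoc,
          ← ENNReal.ofReal_mul (by linarith)]
        · congr 1
          · rw [mul_one_div]
          · refine lintegral_congr fun x => ?_
            rw [ENNReal.ofReal_mul (by positivity)]
        · exact ENNReal.ofReal_ne_top

/-! ### Truncation and constants -/

/-- Cutoff functions `χ k`, equal to `1` near any given point for large `k`, whose gradients are
uniformly bounded when measured with the weight `1 + ‖x‖²`. -/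
theorem exists_cutoff (E : Type*) [NormedAddCommGroup E] [InnerProductSpace ℝ E]
    [FiniteDimensional ℝ E] :
    ∃ (χ : ℕ → E → ℝ) (L : ℝ), (∀ k, ContDiff ℝ 1 (χ k)) ∧ (∀ k, HasCompactSupport (χ k)) ∧
      (∀ k x, |χ k x| ≤ 1) ∧ (∀ k x, ‖fderiv ℝ (χ k) x‖ ^ 2 * (1 + ‖x‖ ^ 2) ≤ L) ∧
      ∀ x, ∀ᶠ k in atTop, χ k =ᶠ[𝓝 x] 1 := by
  let f : ContDiffBump (0 : E) := ⟨1, 2, one_pos, one_lt_two⟩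
  have hf1 : ContDiff ℝ 1 f := f.contDiff
  have hfd : Continuous (fderiv ℝ f) := hf1.continuous_fderiv one_ne_zero
  have hsupp : HasCompactSupport fun y => ‖fderiv ℝ f y‖ * (1 + ‖y‖) :=
    (f.hasCompactSupport.fderiv ℝ).mono fun y hy h => hy (by simp [h])
  obtain ⟨L, hL⟩ := hsupp.exists_bound_of_continuous (by fun_prop)
  refine ⟨fun k x => f (((k : ℝ) + 1)⁻¹ • x), L ^ 2, fun k => ?_, fun k => ?_, fun k x => ?_,
    fun k x => ?_, fun x => ?_⟩
  · exact hf1.comp (contDiff_id.const_smul _)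
  · exact f.hasCompactSupport.comp_smul (by positivity)
  · rw [abs_of_nonneg f.nonneg]; exact f.le_one
  · set r : ℝ := ((k : ℝ) + 1)⁻¹ with hr
    have hr0 : 0 < r := by positivity
    have hr1 : r ≤ 1 := inv_le_one_of_one_le₀ (by linarith [(Nat.cast_nonneg k : (0 : ℝ) ≤ k)])
    have hd : fderiv ℝ (fun x => f (r • x)) x = r • fderiv ℝ f (r • x) :=
      fderiv_comp_smul r
    have h1 : ‖fderiv ℝ (fun x => f (r • x)) x‖ * (1 + ‖x‖) ≤ L := by
      refine le_trans ?_ ((le_abs_self _).trans (hL (r • x)))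
      rw [hd, norm_smul, norm_smul, Real.norm_of_nonneg hr0.le]
      have := norm_nonneg (fderiv ℝ f (r • x))
      nlinarith [mul_nonneg this (norm_nonneg x)]
    have h0 : 0 ≤ ‖fderiv ℝ (fun x => f (r • x)) x‖ * (1 + ‖x‖) := by positivity
    refine le_trans ?_ (pow_le_pow_left₀ h0 h1 2)
    rw [mul_pow]
    have := norm_nonneg x
    gcongr
    nlinarith
  · filter_upwards [(tendsto_natCast_atTop_atTop (R := ℝ)).eventually_gt_atTop ‖x‖] with k hk
    have hk0 : (0 : ℝ) < k + 1 := by positivity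
    have hmem : ((k : ℝ) + 1)⁻¹ • x ∈ Metric.ball (0 : E) f.rIn := by
      rw [mem_ball_zero_iff, norm_smul, norm_inv, Real.norm_of_nonneg hk0.le, inv_mul_lt_iff₀ hk0]
      change ‖x‖ < ((k : ℝ) + 1) * 1
      linarith
    have hc : Tendsto (fun y : E => ((k : ℝ) + 1)⁻¹ • y) (𝓝 x) (𝓝 (((k : ℝ) + 1)⁻¹ • x)) :=
      (continuous_const_smul _).continuousAt
    exact hc.eventually (f.eventuallyEq_one_of_mem_ball hmem)

/-- A weighted Poincaré inequality passes from compactly supported functions to bounded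
functions when the weight is `1 + ‖x‖ ^ 2`. -/
theorem poincare_of_hasCompactSupport {E : Type*} [NormedAddCommGroup E] [InnerProductSpace ℝ E]
    [FiniteDimensional ℝ E] [MeasurableSpace E] [BorelSpace E] {ν : Measure E}
    [IsProbabilityMeasure ν] {c : ENNReal} (hc : c ≠ 0) (hc' : c ≠ ⊤)
    (H : ∀ g : E → ℝ, ContDiff ℝ 1 g → HasCompactSupport g →
      ENNReal.ofReal (∫ x, g x ^ 2 ∂ν - (∫ x, g x ∂ν) ^ 2) ≤
        c * ∫⁻ x, ENNReal.ofReal (‖fderiv ℝ g x‖ ^ 2 * (1 + ‖x‖ ^ 2)) ∂ν)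
    {g : E → ℝ} (hg : ContDiff ℝ 1 g) {M : ℝ} (hM : ∀ x, |g x| ≤ M) :
    ENNReal.ofReal (∫ x, g x ^ 2 ∂ν - (∫ x, g x ∂ν) ^ 2) ≤
      c * ∫⁻ x, ENNReal.ofReal (‖fderiv ℝ g x‖ ^ 2 * (1 + ‖x‖ ^ 2)) ∂ν := by
  by_cases htop : ∫⁻ x, ENNReal.ofReal (‖fderiv ℝ g x‖ ^ 2 * (1 + ‖x‖ ^ 2)) ∂ν = ⊤
  · rw [htop, ENNReal.mul_top hc]; exact le_top
  obtain ⟨χ, L, hχ, hχc, hχ1, hχL, hχlim⟩ := exists_cutoff E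
  have hgk : ∀ k, ContDiff ℝ 1 fun x => χ k x * g x := fun k => (hχ k).mul hg
  have hb : ∀ k x, |χ k x * g x| ≤ M := fun k x => by
    rw [abs_mul]
    calc |χ k x| * |g x| ≤ 1 * M := mul_le_mul (hχ1 k x) (hM x) (abs_nonneg _) zero_le_one
      _ = M := one_mul M
  have heq : ∀ x, ∀ᶠ k in atTop, (fun y => χ k y * g y) =ᶠ[𝓝 x] g := fun x => by
    filter_upwards [hχlim x] with k hk
    filter_upwards [hk] with y hy
    rw [hy, Pi.one_apply, one_mul]
  have lim1 : Tendsto (fun k => ∫ x, χ k x * g x ∂ν) atTop (𝓝 (∫ x, g x ∂ν)) := by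
    refine tendsto_integral_of_dominated_convergence (fun _ => M)
      (fun k => (hgk k).continuous.aestronglyMeasurable) (integrable_const _)
      (fun k => Eventually.of_forall fun x => hb k x) (Eventually.of_forall fun x => ?_)
    exact tendsto_const_nhds.congr' ((heq x).mono fun k hk => hk.eq_of_nhds.symm)
  have lim2 : Tendsto (fun k => ∫ x, (χ k x * g x) ^ 2 ∂ν) atTop (𝓝 (∫ x, g x ^ 2 ∂ν)) := by
    refine tendsto_integral_of_dominated_convergence (fun _ => M ^ 2)
      (fun k => ((hgk k).continuous.pow 2).aestronglyMeasurable) (integrable_const _)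
      (fun k => Eventually.of_forall fun x => ?_) (Eventually.of_forall fun x => ?_)
    · rw [norm_pow]; exact pow_le_pow_left₀ (norm_nonneg _) (hb k x) 2
    · exact tendsto_const_nhds.congr' ((heq x).mono fun k hk => by
        simp only [hk.eq_of_nhds])
  have lim3 : Tendsto (fun k => ∫⁻ x, ENNReal.ofReal
      (‖fderiv ℝ (fun x => χ k x * g x) x‖ ^ 2 * (1 + ‖x‖ ^ 2)) ∂ν) atTop
      (𝓝 (∫⁻ x, ENNReal.ofReal (‖fderiv ℝ g x‖ ^ 2 * (1 + ‖x‖ ^ 2)) ∂ν)) := by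
    refine tendsto_lintegral_of_dominated_convergence (fun x => 2 *
        ENNReal.ofReal (‖fderiv ℝ g x‖ ^ 2 * (1 + ‖x‖ ^ 2)) + ENNReal.ofReal (2 * (M ^ 2 * L)))
      (fun k => ?_) (fun k => Eventually.of_forall fun x => ?_) ?_
      (Eventually.of_forall fun x => ?_)
    · have := (hgk k).continuous_fderiv one_ne_zero
      exact (by fun_prop : Continuous fun x =>
        ‖fderiv ℝ (fun x => χ k x * g x) x‖ ^ 2 * (1 + ‖x‖ ^ 2)).measurable.ennreal_ofReal
    · have hd : fderiv ℝ (fun x => χ k x * g x) x = χ k x • fderiv ℝ g x + g x • fderiv ℝ (χ k) x :=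
        fderiv_fun_mul ((hχ k).differentiable one_ne_zero x) (hg.differentiable one_ne_zero x)
      have h1 : ‖fderiv ℝ (fun x => χ k x * g x) x‖ ≤ ‖fderiv ℝ g x‖ + M * ‖fderiv ℝ (χ k) x‖ := by
        rw [hd]
        refine (norm_add_le _ _).trans (add_le_add ?_ ?_)
        · rw [norm_smul]
          exact mul_le_of_le_one_left (norm_nonneg _) (hχ1 k x)
        · rw [norm_smul]
          exact mul_le_mul_of_nonneg_right (hM x) (norm_nonneg _)
      have h2 : ‖fderiv ℝ (fun x => χ k x * g x) x‖ ^ 2 * (1 + ‖x‖ ^ 2) ≤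
          2 * (‖fderiv ℝ g x‖ ^ 2 * (1 + ‖x‖ ^ 2)) + 2 * (M ^ 2 * L) := by
        calc _ ≤ (‖fderiv ℝ g x‖ + M * ‖fderiv ℝ (χ k) x‖) ^ 2 * (1 + ‖x‖ ^ 2) := by gcongr
          _ ≤ (2 * ‖fderiv ℝ g x‖ ^ 2 + 2 * (M * ‖fderiv ℝ (χ k) x‖) ^ 2) * (1 + ‖x‖ ^ 2) := by
              gcongr
              nlinarith [sq_nonneg (‖fderiv ℝ g x‖ - M * ‖fderiv ℝ (χ k) x‖)]
          _ = 2 * (‖fderiv ℝ g x‖ ^ 2 * (1 + ‖x‖ ^ 2)) +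
              2 * (M ^ 2 * (‖fderiv ℝ (χ k) x‖ ^ 2 * (1 + ‖x‖ ^ 2))) := by ring
          _ ≤ _ := by
              have := hχL k x
              gcongr
      refine (ENNReal.ofReal_le_ofReal h2).trans (ENNReal.ofReal_add_le.trans (le_of_eq ?_))
      rw [ENNReal.ofReal_mul zero_le_two, ENNReal.ofReal_ofNat]
    · rw [lintegral_add_right _ measurable_const, lintegral_const_mul' _ _ (by simp)]
      exact ENNReal.add_ne_top.2 ⟨ENNReal.mul_ne_top (by simp) htop, by
        rw [lintegral_const, measure_univ, mul_one]
        exact ENNReal.ofReal_ne_top⟩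
    · exact tendsto_const_nhds.congr' ((heq x).mono fun k hk => by
        simp only [hk.fderiv_eq])
  exact le_of_tendsto_of_tendsto'
    (ENNReal.tendsto_ofReal (lim2.sub (lim1.pow 2)))
    (ENNReal.Tendsto.const_mul lim3 (Or.inr hc'))
    fun k => H _ (hgk k) (hχc k).mul_right

/-- With `t = 2 / (β - 1)`, this is `(√(1 + t) + √t)² ≥ 1 + 4 t`. -/
theorem one_add_le_cauchyC {β : ℝ} (hβ : 1 < β) : 1 + 8 / (β - 1) ≤ cauchyC β := by
  have hb : 0 < β - 1 := sub_pos.2 hβ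
  set t : ℝ := 2 / (β - 1) with ht
  have ht0 : 0 < t := by positivity
  have h1 : √t ≤ √(1 + t) := Real.sqrt_le_sqrt (by linarith)
  have h2 : √(1 + t) ^ 2 = 1 + t := Real.sq_sqrt (by linarith)
  have h3 : √t ^ 2 = t := Real.sq_sqrt ht0.le
  have h4 : 8 / (β - 1) = 4 * t := by rw [ht]; ring
  rw [cauchyC, ← ht, h4]
  nlinarith [mul_le_mul_of_nonneg_left h1 (Real.sqrt_nonneg t)]

/-- The choice of the exponent `c`. The value `c = 1` gives a constant close to `1` for large `n`,
but needs `β - n / 2 > 1`, which can fail for small `n`; there `c = 1 / 2` is good enough. -/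
theorem exists_gamma_exponent {n : ℕ} {β : ℝ} (hn : (n : ℝ) ≤ β) (hβ : 1 < β) :
    ∃ c : ℝ, 0 < c ∧ c ≤ 1 ∧ c < β - n / 2 ∧ n / (2 * (c * (β - n / 2 - c))) ≤ cauchyC β := by
  have hb : 0 < β - 1 := sub_pos.2 hβ
  have hC := one_add_le_cauchyC hβ
  have e : 1 + 8 / (β - 1) = (β + 7) / (β - 1) := by field_simp; ring
  rw [e] at hC
  rcases le_or_gt n 2 with h2 | h2
  · refine ⟨1 / 2, by norm_num, by norm_num, ?_, le_trans ?_ hC⟩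
    · interval_cases n <;> norm_num at hn ⊢ <;> linarith
    · interval_cases n
      · simp only [Nat.cast_zero, zero_div]
        exact div_nonneg (by linarith) hb.le
      · rw [div_le_div_iff₀ (by norm_num; linarith) hb]
        norm_num
        nlinarith
      · norm_num at hn
        rw [div_le_div_iff₀ (by norm_num; linarith) hb]
        norm_num
        nlinarith
  · have h3 : (3 : ℝ) ≤ n := by exact_mod_cast h2
    refine ⟨1, one_pos, le_rfl, by linarith, le_trans ?_ hC⟩
    rw [div_le_div_iff₀ (by linarith) hb]
    nlinarith [mul_nonneg (sub_nonneg.2 hn) (by linarith : (0 : ℝ) ≤ β + 3)]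

theorem tendsto_cauchyC : Tendsto cauchyC atTop (𝓝 1) := by
  have h : Tendsto (fun β : ℝ => 2 / (β - 1)) atTop (𝓝 0) :=
    tendsto_const_nhds.div_atTop (tendsto_atTop_add_const_right _ (-1) tendsto_id)
  have h1 : Tendsto (fun β : ℝ => √(1 + 2 / (β - 1))) atTop (𝓝 √(1 + 0)) :=
    (Real.continuous_sqrt.tendsto _).comp (h.const_add 1)
  have h2 : Tendsto (fun β : ℝ => √(2 / (β - 1))) atTop (𝓝 √0) :=
    (Real.continuous_sqrt.tendsto _).comp h
  have h3 : Tendsto cauchyC atTop (𝓝 ((√(1 + 0) + √0) ^ 2)) := (h1.add h2).pow 2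
  simpa using h3

theorem theorem3p1 :
    (∀ (n : ℕ) (β : ℝ), (n : ℝ) ≤ β → 1 < β →
      ∀ g : EuclideanSpace ℝ (Fin n) → ℝ, ContDiff ℝ ∞ g → (∃ M : ℝ, ∀ x, |g x| ≤ M) →
        ENNReal.ofReal (variance g (genCauchy n β)) ≤
          ENNReal.ofReal (cauchyC β / (2 * (β - 1))) *
            ∫⁻ x, ENNReal.ofReal (‖gradient g x‖ ^ 2 * (1 + ‖x‖ ^ 2)) ∂(genCauchy n β)) ∧
    Tendsto cauchyC atTop (𝓝 1) := by
  refine ⟨fun n β hn hβ1 g hg hgb => ?_, tendsto_cauchyC⟩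
  obtain ⟨M, hM⟩ := hgb
  have hb : 0 < β - 1 := sub_pos.2 hβ1
  have hβ : (n : ℝ) / 2 < β := by linarith
  have := isProbabilityMeasure_genCauchy n β hβ
  obtain ⟨c, hc0, hc1, hcβ, hcC⟩ := exists_gamma_exponent hn hβ1
  have hC1 : 1 ≤ cauchyC β := le_trans (by have := div_pos (by norm_num : (0 : ℝ) < 8) hb; linarith)
    (one_add_le_cauchyC hβ1)
  have hg1 : ContDiff ℝ 1 g := hg.of_le (by exact_mod_cast le_top)
  have hmem : MemLp g 2 (genCauchy n β) :=
    MemLp.of_bound hg.continuous.aestronglyMeasurable M (Eventually.of_forall hM)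
  have hgrad : ∀ x, ‖gradient g x‖ = ‖fderiv ℝ g x‖ := fun x => by
    rw [gradient, LinearIsometryEquiv.norm_map]
  have hpos : 0 < cauchyC β / (2 * (β - 1)) := by
    have : 0 < cauchyC β := by linarith
    positivity
  rw [variance_eq_sub hmem]
  simp only [hgrad]
  exact poincare_of_hasCompactSupport (ENNReal.ofReal_pos.2 hpos).ne' ENNReal.ofReal_ne_top
    (fun u hu huc =>
      variance_genCauchy_le_of_hasCompactSupport hβ hβ1 hc0 hcβ hc1 hC1 hcC hu huc) hg1 hM
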